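/- **Setting.** Let $\mathcal S,\mathcal A$ be finite sets, $H\in\mathbb N$, $\mu_0$ a probability on $\mathcal S$, $p=(p_h)_{1\le h\le H}$ a transition model ($p_h(\cdot\mid s,a)$ is a probability on $\mathcal S$), $\pi^E=(\pi^E_h)_h$ a deterministic (expert's) policy and $\pi^b=(\pi^b_h(\cdot\mid s))_h$ a stochastic (behavioral) policy. For a policy $\pi$ let $\rho^{p,\pi}_h(s,a)=\mathbb P_{p,\pi}(s_h=s,a_h=a)$, $\rho_h^{p,\pi}(s)=\sum_a\rho_h^{p,\pi}(s,a)$, $\mathcal S^{p,\pi}=\{(s,h):\rho^{p,\pi}_h(s)>0\}$, $\mathcal Z^{p,\pi}=\{(s,a,h):\rho^{p,\pi}_h(s,a)>0\}$, $Z^{p,\pi}=|\mathcal Z^{p,\pi}|$, $S^{p,\pi}=|\mathcal S^{p,\pi}|$, $S^{p,\pi}_{\max}=\max_h|\{s:(s,h)\in\mathcal S^{p,\pi}\}|$, and $\rho_{\min}=\min_{\mathcal Z^{p,\pi^b}}\rho^{p,\pi^b}_h(s,a)$, $\rho^E_{\min}=\min_{\mathcal Z^{p,\pi^E}}\rho^{p,\pi^E}_h(s,a)$.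 A reward is a function $r=(r_h(s,a))$ with real values; $Q^\pi_h(s,a;p,r)$ is the expected reward cumulated from stage $h$ to stage $H$ when $a$ is played in $s$ at stage $h$ and $\pi$ afterwards, and $J(\pi;\mu_0,p,r)$ is the expected total reward of $\pi$ started from $\mu_0$. *Target sets.* $\mathcal R_{p,\pi^E}=\{r: J(\pi^E;\mu_0,p,r)=\max_\pi J(\pi;\mu_0,p,r)\}$. The sub-feasible set $\mathcal R^\cap$ (super-feasible set $\mathcal R^\cup$) is the intersection (union) of the sets $\mathcal R_{p',\pi^E}$ over all transition models $p'$ with $p'_h(\cdot\mid s,a)=p_h(\cdot\mid s,a)$ for all $(s,a,h)\in\mathcal Z^{p,\pi^b}$. *Distance.* With $M=\max\{\|r\|_\infty,\|\hat r\|_\infty\}$, $$d(r,\hat r)=\frac1M\sum_{h=1}^H\Big(\sum_{s,a}\rho_h^{p,\pi^b}(s,a)\,|r_h(s,a)-\hat r_h(s,a)|+\max_{(s,a):(s,a,h)\notin\mathcal Z^{p,\pi^b}}|r_h(s,a)-\hat r_h(s,a)|\Big),$$ where a maximum over the empty set is $0$, and $d=0$ if $M=0$; $\mathcal H_d(\mathcal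 R,\hat{\mathcal R})=\max\{\sup_{r\in\mathcal R}\inf_{\hat r\in\hat{\mathcal R}}d(r,\hat r),\ \sup_{\hat r\in\hat{\mathcal R}}\inf_{r\in\mathcal R}d(r,\hat r)\}$. *Data and algorithm IRLO.* The data are $\tau^b$ trajectories $(s_h,a_h)_{1\le h\le H}$ collected with $\pi^b$ and $\tau^E$ collected with $\pi^E$, all independent. $\hat{\mathcal S}$ is the set of the $(s,h)$ that occur in the expert's data; $\hat\pi^E_h(s)$, for $(s,h)\in\hat{\mathcal S}$, is the action $a_h$ of some expert's trajectory with $s_h=s$ (any rule of choice). $\hat{\mathcal Z}$ is the set of the $(s,a,h)$ that occur in the behavioral data, and for $(s,a,h)\in\hat{\mathcal Z}$ with $h<H$, $\hat p_h(s'\mid s,a)=N_h(s,a,s')/\max\{1,\sum_{x}N_h(s,a,x)\}$, where $N_h(s,a,s')$ is the number of behavioral trajectories with $(s_h,a_h,s_{h+1})=(s,a,s')$. For a transition model $p'$ let $\hat{\mathcal R}_{p'}$ be the set of rewards $r$ such that $Q^{\bar\pi}_h(s,\hat\pi^E_h(s);p',r)\ge Q^{\bar\pi}_h(s,a;p',r)$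 for every policy $\bar\pi$ that plays $\hat\pi^E$ on $\hat{\mathcal S}$, every $(s,h)\in\hat{\mathcal S}$ and every $a\in\mathcal A$. IRLO outputs $\hat{\mathcal R}^\cap$ and $\hat{\mathcal R}^\cup$, the intersection and the union of the sets $\hat{\mathcal R}_{p'}$ over all transition models $p'$ with $p'_h(\cdot\mid s,a)=\hat p_h(\cdot\mid s,a)$ for all $(s,a,h)\in\hat{\mathcal Z}$ with $h<H$. **Theorem.** There is a universal constant $C>0$ such that the following holds in the above setting. Suppose that $\pi^b_h(\pi^E_h(s)\mid s)>0$ for all $(s,h)\in\mathcal S^{p,\pi^E}$. Let $\varepsilon\in(0,2H]$, $\delta\in(0,1)$, and put $L=\ln\frac{4Z^{p,\pi^b}}{\delta}$ and $X=\frac{H^3Z^{p,\pi^b}L}{\varepsilon^2}$. If $\tau^E\ge1$ and $$\tau^b\ \ge\ C\left(X\Big(L+S^{p,\pi^b}_{\max}\ln(e+X)\Big)+\frac{L}{\ln\frac1{1-\rho_{\min}}}\right),\qquad \tau^E\ \ge\ C\,\frac{\ln\frac{4S^{p,\pi^E}}{\delta}}{\ln\frac1{1-\rho^E_{\min}}}$$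 (a quotient by $\ln\frac1{1-\rho}$ being $0$ when $\rho=1$), then $$\mathbb P\Big(\mathcal H_d(\mathcal R^\cap,\hat{\mathcal R}^\cap)\le\varepsilon\ \text{ and }\ \mathcal H_d(\mathcal R^\cup,\hat{\mathcal R}^\cup)\le\varepsilon\Big)\ \ge\ 1-\delta .$$ That is, IRLO is $(\varepsilon,\delta)$-PAC with $$\tau^b\le\widetilde{\mathcal O}\left(\frac{H^3Z^{p,\pi^b}\ln\frac1\delta}{\varepsilon^2}\Big(\ln\frac1\delta+S^{p,\pi^b}_{\max}\Big)+\frac{\ln\frac1\delta}{\ln\frac1{1-\rho_{\min}}}\right),\qquad \tau^E\le\widetilde{\mathcal O}\left(\frac{\ln\frac1\delta}{\ln\frac1{1-\rho^E_{\min}}}\right),$$ where the logarithmic factors hidden in $\widetilde{\mathcal O}$ are those displayed above. -/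

import Mathlib

open scoped ENNReal

namespace OfflineIRL

noncomputable section

/-! Stages are indexed by `Fin H`, i.e. the stages `1, …, H` are written `0, …, H - 1`. -/

/-- Transition models: `p h s a` is the law of the next state after playing `a` in `s` at `h`. -/
abbrev Transition (S A : Type*) [Fintype S] (H : ℕ) := Fin H → S → A → stdSimplex ℝ S

/-- (Stochastic, time-dependent) policies: `π h s` is a law on actions. -/
abbrev Policy (S A : Type*) [Fintype A] (H : ℕ) := Fin H → S → stdSimplex ℝ A

/-- Deterministic policies. -/
abbrev DetPolicy (S A : Type*) (H : ℕ) := Fin H → S → A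

/-- Real-valued rewards, not assumed bounded by any constant; the norm `‖r‖` is the sup norm. -/
abbrev Reward (S A : Type*) (H : ℕ) := Fin H → S → A → ℝ

/-- Trajectories `(s_h, a_h)` for `h` in the `H` stages. -/
abbrev Traj (S A : Type*) (H : ℕ) := Fin H → S × A

/-- Datasets of `τ` trajectories. -/
abbrev Dataset (S A : Type*) (H τ : ℕ) := Fin τ → Traj S A H

section Model

variable {S A : Type*} [Fintype S] [Fintype A] [DecidableEq S] [DecidableEq A] {H : ℕ}

/-- A deterministic policy seen as a policy. -/
def DetPolicy.toPolicy (π : DetPolicy S A H) : Policy S A H :=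
  fun h s => stdSimplex.vertex (π h s)

/-! ### Trajectories and visitation distributions -/

/-- The probability of the state at stage `h` of the trajectory `ω`, given the preceding
stage: `μ₀(s_1)` at the first stage and `p_{h-1}(s_h | s_{h-1}, a_{h-1})` at the later ones. -/
def stateWeight (μ₀ : stdSimplex ℝ S) (p : Transition S A H) (ω : Traj S A H) (h : Fin H) : ℝ :=
  if h.val = 0 then μ₀ (ω h).1
  else
    let g : Fin H := ⟨h.val - 1, lt_of_le_of_lt (Nat.sub_le _ _) h.isLt⟩
    p g (ω g).1 (ω g).2 (ω h).1

/-- The probability of a trajectory when `π` is played in the transition model `p`. -/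
def trajProb (μ₀ : stdSimplex ℝ S) (p : Transition S A H) (π : Policy S A H)
    (ω : Traj S A H) : ℝ :=
  ∏ h : Fin H, stateWeight μ₀ p ω h * π h (ω h).1 (ω h).2

/-- `ρ_h(s,a) = P(s_h = s, a_h = a)`. -/
def visitSA (μ₀ : stdSimplex ℝ S) (p : Transition S A H) (π : Policy S A H)
    (h : Fin H) (s : S) (a : A) : ℝ :=
  ∑ ω : Traj S A H, if ω h = (s, a) then trajProb μ₀ p π ω else 0

/-- `ρ_h(s) = ∑ₐ ρ_h(s,a)`. -/
def visitS (μ₀ : stdSimplex ℝ S) (p : Transition S A H) (π : Policy S A H)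
    (h : Fin H) (s : S) : ℝ :=
  ∑ a : A, visitSA μ₀ p π h s a

/-- The set of pairs `(s,h)` visited with positive probability. -/
def suppS (μ₀ : stdSimplex ℝ S) (p : Transition S A H) (π : Policy S A H) : Set (S × Fin H) :=
  {x | 0 < visitS μ₀ p π x.2 x.1}

/-- The set of triples `(s,a,h)` visited with positive probability. -/
def suppSA (μ₀ : stdSimplex ℝ S) (p : Transition S A H) (π : Policy S A H) :
    Set (S × A × Fin H) :=
  {x | 0 < visitSA μ₀ p π x.2.2 x.1 x.2.1}

/-- The maximum over the stages `h` of the number of states visited with positive probability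
at stage `h`. -/
def suppSMax (μ₀ : stdSimplex ℝ S) (p : Transition S A H) (π : Policy S A H) : ℕ :=
  Finset.univ.sup fun h : Fin H => {s : S | (s, h) ∈ suppS μ₀ p π}.ncard

/-- The minimum of `ρ_h(s,a)` over the triples `(s,a,h)` visited with positive probability
(a finite set, nonempty as soon as `1 ≤ H`). -/
def visitMin (μ₀ : stdSimplex ℝ S) (p : Transition S A H) (π : Policy S A H) : ℝ :=
  ⨅ x : suppSA μ₀ p π, visitSA μ₀ p π x.1.2.2 x.1.1 x.1.2.1

/-! ### Value functions -/

/-- The expected cumulated reward of `π` from stage `h` in state `s`, by recursion on the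
stages; it is `0` after the last stage. -/
def value (p : Transition S A H) (π : Policy S A H) (r : Reward S A H) (h : ℕ) (s : S) : ℝ :=
  if hh : h < H then
    ∑ a : A, π ⟨h, hh⟩ s a *
      (r ⟨h, hh⟩ s a + ∑ s' : S, p ⟨h, hh⟩ s a s' * value p π r (h + 1) s')
  else 0
termination_by H - h

/-- The Q-function: the expected cumulated reward from stage `h` when `a` is played in `s` at
stage `h` and `π` is played afterwards. -/
def qValue (p : Transition S A H) (π : Policy S A H) (r : Reward S A H)
    (h : Fin H) (s : S) (a : A) : ℝ :=
  r h s a + ∑ s' : S, p h s a s' * value p π r (h.val + 1) s'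

/-- The utility (expected return) of `π`. -/
def utility (μ₀ : stdSimplex ℝ S) (p : Transition S A H) (π : Policy S A H)
    (r : Reward S A H) : ℝ :=
  ∑ s : S, μ₀ s * value p π r 0 s

/-! ### Feasible sets -/

/-- The policies that agree with `π` on the set `X` of pairs `(s,h)`. -/
def policyClass (X : Set (S × Fin H)) (π : Policy S A H) : Set (Policy S A H) :=
  {π' | ∀ s h, (s, h) ∈ X → π' h s = π h s}

/-- The transition models that agree with `p` on the set `Z` of triples `(s,a,h)`. -/
def transitionClass (Z : Set (S × A × Fin H)) (p : Transition S A H) : Set (Transition S A H) :=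
  {p' | ∀ s a h, (s, a, h) ∈ Z → p' h s a = p h s a}

/-- The feasible set: the rewards for which the expert's policy maximizes the utility. -/
def feasible (μ₀ : stdSimplex ℝ S) (p : Transition S A H) (πE : DetPolicy S A H) :
    Set (Reward S A H) :=
  {r | ∀ π : Policy S A H, utility μ₀ p π r ≤ utility μ₀ p πE.toPolicy r}

/-- The sub-feasible set. -/
def subFeasible (μ₀ : stdSimplex ℝ S) (p : Transition S A H) (πE : DetPolicy S A H)
    (πb : Policy S A H) : Set (Reward S A H) :=
  ⋂ p' ∈ transitionClass (suppSA μ₀ p πb) p, feasible μ₀ p' πE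

/-- The super-feasible set. -/
def superFeasible (μ₀ : stdSimplex ℝ S) (p : Transition S A H) (πE : DetPolicy S A H)
    (πb : Policy S A H) : Set (Reward S A H) :=
  ⋃ p' ∈ transitionClass (suppSA μ₀ p πb) p, feasible μ₀ p' πE

/-! ### Dissimilarities -/

/-- The semimetric `d` between rewards. The inner `⨆` is a maximum over a finite set, read as
`0` when that set is empty; if `r = r' = 0` the quotient is `0`. -/
def rewardDist (μ₀ : stdSimplex ℝ S) (p : Transition S A H) (πb : Policy S A H)
    (r r' : Reward S A H) : ℝ :=
  (∑ h : Fin H,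
    ((∑ s : S, ∑ a : A, visitSA μ₀ p πb h s a * |r h s a - r' h s a|) +
      ⨆ x : {x : S × A // (x.1, x.2, h) ∉ suppSA μ₀ p πb},
        |r h x.1.1 x.1.2 - r' h x.1.1 x.1.2|)) / max ‖r‖ ‖r'‖

/-- The Hausdorff distance between two sets of rewards with inner distance `c ≥ 0`. -/
def hausdorff (c : Reward S A H → Reward S A H → ℝ) (R R' : Set (Reward S A H)) : ℝ≥0∞ :=
  max (⨆ r ∈ R, ⨅ r' ∈ R', ENNReal.ofReal (c r r'))
    (⨆ r' ∈ R', ⨅ r ∈ R, ENNReal.ofReal (c r r'))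

/-! ### The algorithm -/

/-- The empirical expert's support: pairs `(s,h)` that occur in the dataset. -/
def empSuppS {τ : ℕ} (D : Dataset S A H τ) : Set (S × Fin H) :=
  {x | ∃ i, (D i x.2).1 = x.1}

/-- `π` is an empirical expert's policy: at each pair `(s,h)` that occurs in the dataset it
plays the action of some trajectory that passes through that pair. -/
def IsEmpPolicy {τ : ℕ} (D : Dataset S A H τ) (π : DetPolicy S A H) : Prop :=
  ∀ s h, (s, h) ∈ empSuppS D → ∃ i, (D i h).1 = s ∧ π h s = (D i h).2

/-- The empirical behavioral support: triples `(s,a,h)` that occur in the dataset. -/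
def empSuppSA {τ : ℕ} (D : Dataset S A H τ) : Set (S × A × Fin H) :=
  {x | ∃ i, D i x.2.2 = (x.1, x.2.1)}

/-- The number of trajectories with `(s_h, a_h, s_{h+1}) = (s, a, s')`, at a stage `h` that is
not the last one. -/
def count {τ : ℕ} (D : Dataset S A H τ) (h : Fin H) (hh : h.val + 1 < H) (s : S) (a : A)
    (s' : S) : ℕ :=
  (Finset.univ.filter fun i : Fin τ => D i h = (s, a) ∧ (D i ⟨h.val + 1, hh⟩).1 = s').card

/-- The empirical transition probabilities at a stage that is not the last one. -/
def empTransition {τ : ℕ} (D : Dataset S A H τ) (h : Fin H) (hh : h.val + 1 < H) (s : S) (a : A)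
    (s' : S) : ℝ :=
  (count D h hh s a s' : ℝ) / (max 1 (∑ x : S, count D h hh s a x) : ℕ)

/-- The transition models that agree with the empirical one on the empirical behavioral
support. There is no condition at the last stage: trajectories stop there, so that nothing is
observed of the last transition, and no Q-function depends on it. -/
def empTransitionClass {τ : ℕ} (D : Dataset S A H τ) : Set (Transition S A H) :=
  {p' | ∀ s a h, (s, a, h) ∈ empSuppSA D → ∀ hh : h.val + 1 < H, ∀ s',
    p' h s a s' = empTransition D h hh s a s'}

/-- The rewards for which, in `p'`, the actions of the deterministic policy `π` are optimal on
the set `X` of pairs `(s,h)`, whatever is played outside `X`. For `X` the support of `π` in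
`p'` this is the feasible set; it makes sense without the initial law and for a policy that is
only known on `X`. -/
def feasibleOn (X : Set (S × Fin H)) (p' : Transition S A H) (π : DetPolicy S A H) :
    Set (Reward S A H) :=
  {r | ∀ π' ∈ policyClass X π.toPolicy, ∀ s h, (s, h) ∈ X → ∀ a,
    qValue p' π' r h s a ≤ qValue p' π' r h s (π h s)}

/-- The estimated sub-feasible set, where `π` is the empirical expert's policy. -/
def irloSub {τb τE : ℕ} (Db : Dataset S A H τb) (DE : Dataset S A H τE) (π : DetPolicy S A H) :
    Set (Reward S A H) :=
  ⋂ p' ∈ empTransitionClass Db, feasibleOn (empSuppS DE) p' π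

/-- The estimated super-feasible set, where `π` is the empirical expert's policy. -/
def irloSuper {τb τE : ℕ} (Db : Dataset S A H τb) (DE : Dataset S A H τE) (π : DetPolicy S A H) :
    Set (Reward S A H) :=
  ⋃ p' ∈ empTransitionClass Db, feasibleOn (empSuppS DE) p' π

/-- IRLO. The parameter `est` is the rule that picks, for each expert's dataset, the empirical
expert's policy (the algorithm leaves the choice among the observed actions open). -/
def irlo {τb τE : ℕ} (est : Dataset S A H τE → DetPolicy S A H)
    (D : Dataset S A H τb × Dataset S A H τE) : Set (Reward S A H) × Set (Reward S A H) :=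
  (irloSub D.1 D.2 (est D.2), irloSuper D.1 D.2 (est D.2))

/-! ### The PAC requirement -/

/-- The probability of an event about the two datasets, made of independent trajectories that
are collected with `πb` and with `πE`. -/
def dataProb {τb τE : ℕ} (μ₀ : stdSimplex ℝ S) (p : Transition S A H) (πE : DetPolicy S A H)
    (πb : Policy S A H) (E : Set (Dataset S A H τb × Dataset S A H τE)) : ℝ :=
  ∑ D : Dataset S A H τb × Dataset S A H τE,
    E.indicator (fun D => (∏ i, trajProb μ₀ p πb (D.1 i)) *
      ∏ j, trajProb μ₀ p πE.toPolicy (D.2 j)) D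

/-- The `(ε,δ)`-PAC requirement, for the semimetric `d`, on an algorithm `alg` that outputs the
estimated sub- and super-feasible sets from `τb` behavioral and `τE` expert trajectories. -/
def IsPAC {τb τE : ℕ} (μ₀ : stdSimplex ℝ S) (p : Transition S A H) (πE : DetPolicy S A H)
    (πb : Policy S A H) (ε δ : ℝ)
    (alg : Dataset S A H τb × Dataset S A H τE → Set (Reward S A H) × Set (Reward S A H)) :
    Prop :=
  1 - δ ≤ dataProb μ₀ p πE πb
    {D | hausdorff (rewardDist μ₀ p πb) (subFeasible μ₀ p πE πb) (alg D).1 ≤ ENNReal.ofReal ε ∧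
      hausdorff (rewardDist μ₀ p πb) (superFeasible μ₀ p πE πb) (alg D).2 ≤ ENNReal.ofReal ε}

/-- With `Z` the size of the behavioral state-action support, `M` the maximal number of states
in the behavioral support at a stage, `ρ` the minimal visitation probability, and
`L = ln (4Z/δ)`: the number
`H³ Z L / ε² · (L + M ln (e + H³ Z L / ε²)) + L / ln (1 / (1 - ρ))`.
For `ρ = 1` the last quotient is `0`. -/
def behavioralBound (μ₀ : stdSimplex ℝ S) (p : Transition S A H) (πb : Policy S A H)
    (ε δ : ℝ) : ℝ :=
  let Z : ℝ := (suppSA μ₀ p πb).ncard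
  let M : ℝ := suppSMax μ₀ p πb
  let L : ℝ := Real.log (4 * Z / δ)
  let X : ℝ := (H : ℝ) ^ 3 * Z * L / ε ^ 2
  X * (L + M * Real.log (Real.exp 1 + X)) + L / Real.log (1 / (1 - visitMin μ₀ p πb))

/-- `ln (4N/δ) / ln (1 / (1 - ρ))`, with `N` the size of the expert's state support and `ρ` the
minimal visitation probability of the expert. For `ρ = 1` the quotient is `0`. -/
def expertBound (μ₀ : stdSimplex ℝ S) (p : Transition S A H) (πE : DetPolicy S A H)
    (δ : ℝ) : ℝ :=
  Real.log (4 * ((suppS μ₀ p πE.toPolicy).ncard : ℝ) / δ) /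
    Real.log (1 / (1 - visitMin μ₀ p πE.toPolicy))

end Model

end

end OfflineIRL

set_option linter.unusedSectionVars false

open scoped ENNReal

namespace OfflineIRL

noncomputable section

/-! ### Optimal values for a general one-step lookahead operator -/

section Bellman

/-! Write X for the expert's state support and Z for the behavioral state-action support. By
coverage, the expert's actions on X lie in Z. So X is closed under the expert's play in every model
that agrees with `p` on Z, and feasibility in such a model means that the expert's actions are
greedy on X for the optimal Q-function (`feasible_eq_greedyOn`, `feasibleOn_eq_greedyOn`). The
intersection over models is again a greediness condition, for the operator that sends every pair
outside Z to the best next state (`iInter_feasibleOn_eq_greedyOn`).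

Greediness depends on the reward only through its optimal Q-function, and any Q-function can be
realized in another model: with V the optimal values of `r` for an operator T, the reward r' = Q -
T'V has the same Q for T' (`exists_isClose_of_lookahead`). If T and T' agree outside Z and are
expectations under `p` and `q` on Z, then r' equals r outside Z and differs from it on Z by at most
H‖r‖ times the ℓ¹-distance of the rows. The normalization in the semimetric cancels ‖r‖, so rewards
need no a priori bound, and both Hausdorff distances are at most H ∑ ρ ‖p - q‖₁
(`rewardDist_le_of_isClose`, `irlo_hausdorff_le`).

It remains to estimate rows. When every element of both supports is observed, the sets output by
IRLO are those of an empirical model with the same X and Z. With t = L + S_max, exponential moments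
give ρ‖p - q‖₁ ≤ 6√(ρt/τ) at each triple of Z outside a small event: few visits are harmless because
they have small ρ (`mul_deviation_le_sqrt`). Cauchy–Schwarz gives ∑√ρ ≤ √(ZH)
(`sum_sqrt_visitSA_le`), so τ ≥ 36H³Zt/ε² suffices. Three failures per behavioral triple and one per
expert's state have total probability at most 3δ/4 + δ/4. Failure events are handled through
nonnegative functions that are at least 1 on them, so that only expectations are computed
(`isPAC_of_bad`). -/

theorem backward_induction {H : ℕ} {P : ℕ → Prop} (last : ∀ h, H ≤ h → P h)
    (step : ∀ h, h < H → P (h + 1) → P h) (h : ℕ) : P h := by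
  by_cases hh : H ≤ h
  · exact last h hh
  · induction hk : H - h generalizing h with
    | zero => omega
    | succ k ih =>
      refine step h (by omega) ?_
      by_cases h1 : H ≤ h + 1
      · exact last _ h1
      · exact ih (h + 1) h1 (by omega)

variable {S A : Type*} [Fintype S] [Fintype A] {H : ℕ}

/-- One-step lookahead operators: `T h s a v` evaluates the function `v` of the next state. -/
abbrev Lookahead (S A : Type*) (H : ℕ) := Fin H → S → A → (S → ℝ) → ℝ

/-- The optimal value function of the lookahead operator `T`. -/
def optVal (T : Lookahead S A H) (r : Reward S A H) (h : ℕ) (s : S) : ℝ :=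
  if hh : h < H then
    ⨆ a : A, (r ⟨h, hh⟩ s a + T ⟨h, hh⟩ s a (optVal T r (h + 1)))
  else 0
termination_by H - h

/-- The optimal Q-function of the lookahead operator `T`. -/
def optQ (T : Lookahead S A H) (r : Reward S A H) (h : Fin H) (s : S) (a : A) : ℝ :=
  r h s a + T h s a (optVal T r (h.val + 1))

/-- The expectation of the next value in a transition model. -/
def expect (p : Transition S A H) : Lookahead S A H :=
  fun h s a v => ∑ s', p h s a s' * v s'

open Classical in
/-- The largest expected next value over the models that agree with `p` on `Z`. -/
def optimistic (Z : Set (S × A × Fin H)) (p : Transition S A H) : Lookahead S A H :=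
  fun h s a v => if (s, a, h) ∈ Z then expect p h s a v else ⨆ s', v s'

theorem optVal_of_le (T : Lookahead S A H) (r : Reward S A H) {h : ℕ} (hh : H ≤ h) :
    optVal T r h = 0 := by
  funext s
  rw [optVal, dif_neg (by omega)]
  rfl

theorem optVal_eq_iSup (T : Lookahead S A H) (r : Reward S A H) (h : Fin H) (s : S) :
    optVal T r h s = ⨆ a, optQ T r h s a := by
  rw [optVal, dif_pos h.isLt]
  rfl

theorem optQ_le_optVal (T : Lookahead S A H) (r : Reward S A H) (h : Fin H) (s : S) (a : A) :
    optQ T r h s a ≤ optVal T r h s := by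
  rw [optVal_eq_iSup]
  exact le_ciSup (f := fun a => optQ T r h s a) (Set.finite_range _).bddAbove a

theorem optVal_eq_of_forall_le {T : Lookahead S A H} {r : Reward S A H} {h : Fin H} {s : S}
    {a : A} (ha : ∀ b, optQ T r h s b ≤ optQ T r h s a) : optVal T r h s = optQ T r h s a := by
  refine le_antisymm ?_ (optQ_le_optVal T r h s a)
  have : Nonempty A := ⟨a⟩
  rw [optVal_eq_iSup]
  exact ciSup_le ha

theorem exists_greedy [Nonempty A] (T : Lookahead S A H) (r : Reward S A H) (h : Fin H) (s : S) :
    ∃ a, ∀ b, optQ T r h s b ≤ optQ T r h s a :=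
  Finite.exists_max _

/-- If the reward compensates the change of lookahead operator at the optimal value function,
then the optimal value function is unchanged. -/
theorem optVal_transfer {T T' : Lookahead S A H} {r r' : Reward S A H}
    (hr : ∀ h s a, r' h s a + T' h s a (optVal T r (h.val + 1)) = optQ T r h s a) :
    optVal T' r' = optVal T r := by
  funext h
  refine backward_induction (H := H) (P := fun h => optVal T' r' h = optVal T r h) ?_ ?_ h
  · intro h hh
    rw [optVal_of_le _ _ hh, optVal_of_le _ _ hh]
  · intro h hh ih
    funext s
    rw [optVal_eq_iSup T' r' ⟨h, hh⟩, optVal_eq_iSup T r ⟨h, hh⟩]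
    congr 1
    funext a
    rw [← hr, optQ, ih]

theorem optQ_transfer {T T' : Lookahead S A H} {r r' : Reward S A H}
    (hr : ∀ h s a, r' h s a + T' h s a (optVal T r (h.val + 1)) = optQ T r h s a) :
    optQ T' r' = optQ T r := by
  funext h s a
  rw [optQ, optVal_transfer hr, hr]

theorem expect_mono (p : Transition S A H) (h : Fin H) (s : S) (a : A) {v w : S → ℝ}
    (hvw : v ≤ w) : expect p h s a v ≤ expect p h s a w :=
  Finset.sum_le_sum fun s' _ => mul_le_mul_of_nonneg_left (hvw s') (stdSimplex.zero_le _ _)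

theorem expect_le_of_forall_le (p : Transition S A H) (h : Fin H) (s : S) (a : A) {v : S → ℝ}
    {B : ℝ} (hv : ∀ s', v s' ≤ B) : expect p h s a v ≤ B := by
  calc expect p h s a v ≤ ∑ s', p h s a s' * B :=
        Finset.sum_le_sum fun s' _ => mul_le_mul_of_nonneg_left (hv s') (stdSimplex.zero_le _ _)
    _ = B := by rw [← Finset.sum_mul, stdSimplex.sum_eq_one, one_mul]

theorem le_expect_of_forall_le (p : Transition S A H) (h : Fin H) (s : S) (a : A) {v : S → ℝ}
    {B : ℝ} (hv : ∀ s', B ≤ v s') : B ≤ expect p h s a v := by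
  calc B = ∑ s', p h s a s' * B := by rw [← Finset.sum_mul, stdSimplex.sum_eq_one, one_mul]
    _ ≤ expect p h s a v :=
        Finset.sum_le_sum fun s' _ => mul_le_mul_of_nonneg_left (hv s') (stdSimplex.zero_le _ _)

theorem abs_expect_le (p : Transition S A H) (h : Fin H) (s : S) (a : A) {v : S → ℝ}
    {B : ℝ} (hv : ∀ s', |v s'| ≤ B) : |expect p h s a v| ≤ B :=
  abs_le.2 ⟨le_expect_of_forall_le p h s a fun s' => (abs_le.1 (hv s')).1,
    expect_le_of_forall_le p h s a fun s' => (abs_le.1 (hv s')).2⟩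

theorem abs_iSup_le {ι : Type*} [Finite ι] [Nonempty ι] {v : ι → ℝ} {B : ℝ}
    (hv : ∀ i, |v i| ≤ B) : |⨆ i, v i| ≤ B := by
  obtain ⟨i⟩ := ‹Nonempty ι›
  have : Nonempty ι := ⟨i⟩
  exact abs_le.2 ⟨(abs_le.1 (hv i)).1.trans (le_ciSup (f := v) (Set.finite_range _).bddAbove i),
    ciSup_le fun j => (abs_le.1 (hv j)).2⟩

theorem abs_optimistic_le [Nonempty S] (Z : Set (S × A × Fin H)) (p : Transition S A H)
    (h : Fin H) (s : S) (a : A) {v : S → ℝ} {B : ℝ} (hv : ∀ s', |v s'| ≤ B) :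
    |optimistic Z p h s a v| ≤ B := by
  unfold optimistic
  split_ifs
  · exact abs_expect_le p h s a hv
  · exact abs_iSup_le hv

theorem expect_le_optimistic {Z : Set (S × A × Fin H)} {p p' : Transition S A H}
    (hp : p' ∈ transitionClass Z p) (h : Fin H) (s : S) (a : A) (v : S → ℝ) :
    expect p' h s a v ≤ optimistic Z p h s a v := by
  unfold optimistic
  split_ifs with hz
  · rw [expect, expect, hp s a h hz]
  · exact expect_le_of_forall_le p' h s a fun s' =>
      le_ciSup (f := v) (Set.finite_range _).bddAbove s'

theorem optVal_le_optVal [Nonempty A] {p : Transition S A H} {T : Lookahead S A H}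
    (hT : ∀ h s a v, expect p h s a v ≤ T h s a v)
    (r : Reward S A H) (hmono : ∀ h s a, Monotone (T h s a)) (h : ℕ) :
    optVal (expect p) r h ≤ optVal T r h := by
  refine backward_induction (H := H)
    (P := fun h => optVal (expect p) r h ≤ optVal T r h) ?_ ?_ h
  · intro h hh
    rw [optVal_of_le _ _ hh, optVal_of_le _ _ hh]
  · intro h hh ih s
    rw [optVal_eq_iSup _ r ⟨h, hh⟩]
    refine ciSup_le fun a => (?_ : _ ≤ optQ T r ⟨h, hh⟩ s a).trans (optQ_le_optVal T r ⟨h, hh⟩ s a)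
    exact add_le_add le_rfl ((hT _ _ _ _).trans (hmono _ _ _ ih))

theorem optimistic_mono (Z : Set (S × A × Fin H)) (p : Transition S A H)
    (h : Fin H) (s : S) (a : A) : Monotone (optimistic Z p h s a) := by
  intro v w hvw
  unfold optimistic
  split_ifs
  · exact expect_mono p h s a hvw
  · exact ciSup_mono (Set.finite_range _).bddAbove hvw

theorem abs_reward_le_norm (r : Reward S A H) (h : Fin H) (s : S) (a : A) : |r h s a| ≤ ‖r‖ :=
  ((norm_le_pi_norm (r h s) a).trans (norm_le_pi_norm (r h) s)).trans (norm_le_pi_norm r h)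

theorem abs_optVal_le [Nonempty A] {T : Lookahead S A H}
    (hT : ∀ h s a v B, (∀ s', |v s'| ≤ B) → |T h s a v| ≤ B) (r : Reward S A H) (h : ℕ) (s : S) :
    |optVal T r h s| ≤ H * ‖r‖ := by
  -- The sharp bound counts the remaining stages; truncated subtraction makes it 0 past the horizon.
  have key : ∀ h, ∀ s, |optVal T r h s| ≤ (H - h : ℕ) * ‖r‖ := by
    refine backward_induction (H := H) ?_ ?_
    · intro h hh s
      rw [optVal_of_le _ _ hh]
      simp only [Pi.zero_apply, abs_zero]
      positivity
    · intro h hh ih s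
      rw [optVal_eq_iSup _ r ⟨h, hh⟩]
      refine abs_iSup_le fun a => ?_
      calc |optQ T r ⟨h, hh⟩ s a| ≤ ‖r‖ + (H - (h + 1) : ℕ) * ‖r‖ :=
            (abs_add_le _ _).trans (add_le_add (abs_reward_le_norm r _ s a) (hT _ _ _ _ _ ih))
        _ = (H - h : ℕ) * ‖r‖ := by
            have : H - h = H - (h + 1) + 1 := by omega
            rw [this]; push_cast; ring
  refine (key h s).trans (mul_le_mul_of_nonneg_right ?_ (norm_nonneg _))
  exact_mod_cast Nat.sub_le H h

/-! ### Values of policies -/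

theorem value_of_le (p : Transition S A H) (π : Policy S A H) (r : Reward S A H) {h : ℕ}
    (hh : H ≤ h) : value p π r h = 0 := by
  funext s
  rw [value, dif_neg (by omega)]
  rfl

theorem value_eq_sum (p : Transition S A H) (π : Policy S A H) (r : Reward S A H)
    (h : Fin H) (s : S) : value p π r h s = ∑ a, π h s a * qValue p π r h s a := by
  rw [value, dif_pos h.isLt]
  rfl

theorem qValue_eq (p : Transition S A H) (π : Policy S A H) (r : Reward S A H)
    (h : Fin H) (s : S) (a : A) :
    qValue p π r h s a = r h s a + expect p h s a (value p π r (h.val + 1)) := rfl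

theorem value_le_optVal (p : Transition S A H) (π : Policy S A H) (r : Reward S A H) (h : ℕ) :
    value p π r h ≤ optVal (expect p) r h := by
  refine backward_induction (H := H)
    (P := fun h => value p π r h ≤ optVal (expect p) r h) ?_ ?_ h
  · intro h hh
    rw [optVal_of_le _ _ hh, value_of_le _ _ _ hh]
  · intro h hh ih s
    rw [value_eq_sum p π r ⟨h, hh⟩]
    calc ∑ a, π ⟨h, hh⟩ s a * qValue p π r ⟨h, hh⟩ s a
        ≤ ∑ a, π ⟨h, hh⟩ s a * optVal (expect p) r h s := by
          refine Finset.sum_le_sum fun a _ =>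
            mul_le_mul_of_nonneg_left ?_ (stdSimplex.zero_le _ _)
          exact (add_le_add le_rfl (expect_mono p _ _ _ ih)).trans
            (optQ_le_optVal (expect p) r ⟨h, hh⟩ s a)
      _ = optVal (expect p) r h s := by
          rw [← Finset.sum_mul, stdSimplex.sum_eq_one, one_mul]

theorem qValue_le_optQ (p : Transition S A H) (π : Policy S A H) (r : Reward S A H)
    (h : Fin H) (s : S) (a : A) : qValue p π r h s a ≤ optQ (expect p) r h s a :=
  add_le_add le_rfl (expect_mono p _ _ _ (value_le_optVal p π r _))

variable [DecidableEq A]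

theorem vertex_apply (a b : A) :
    (stdSimplex.vertex a : stdSimplex ℝ A) b = if b = a then 1 else 0 := by
  change (Pi.single a (1 : ℝ) : A → ℝ) b = _
  rw [Pi.single_apply]

theorem value_of_eq_vertex {p : Transition S A H} {π : Policy S A H} {h : Fin H} {s : S} {a : A}
    (hπ : π h s = stdSimplex.vertex a) (r : Reward S A H) :
    value p π r h s = qValue p π r h s a := by
  rw [value_eq_sum, hπ]
  simp [vertex_apply]

/-- `X` is closed under the transitions of `p` when `π` is played. -/
def IsClosedUnder (X : Set (S × Fin H)) (p : Transition S A H) (π : DetPolicy S A H) : Prop :=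
  ∀ s (h h' : Fin H), h'.val = h.val + 1 → (s, h) ∈ X → ∀ s', 0 < p h s (π h s) s' → (s', h') ∈ X

/-- Functions that agree on the next layer of a closed set have the same expectation. -/
theorem IsClosedUnder.expect_congr {X : Set (S × Fin H)} {p : Transition S A H}
    {π : DetPolicy S A H} (hX : IsClosedUnder X p π) {h : Fin H} {s : S} (hs : (s, h) ∈ X)
    {v w : S → ℝ} (hvw : ∀ hh : h.val + 1 < H, ∀ s', (s', ⟨h.val + 1, hh⟩) ∈ X → v s' = w s')
    (hlast : ¬ h.val + 1 < H → v = w) :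
    expect p h s (π h s) v = expect p h s (π h s) w := by
  by_cases hh : h.val + 1 < H
  · refine Finset.sum_congr rfl fun s' _ => ?_
    rcases (stdSimplex.zero_le (p h s (π h s)) s').eq_or_lt with h0 | h0
    · rw [← h0, zero_mul, zero_mul]
    · rw [hvw hh s' (hX s h ⟨h.val + 1, hh⟩ rfl hs s' h0)]
  · rw [hlast hh]

/-- The rewards for which the actions of `π` are greedy on `X` for the lookahead operator `T`. -/
def greedyOn (X : Set (S × Fin H)) (T : Lookahead S A H) (π : DetPolicy S A H) :
    Set (Reward S A H) :=
  {r | ∀ s h, (s, h) ∈ X → ∀ a, optQ T r h s a ≤ optQ T r h s (π h s)}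

theorem value_eq_optVal_of_greedyOn {X : Set (S × Fin H)} {p : Transition S A H}
    {π : DetPolicy S A H} (hX : IsClosedUnder X p π) {r : Reward S A H}
    (hr : r ∈ greedyOn X (expect p) π) {π' : Policy S A H}
    (hπ' : π' ∈ policyClass X π.toPolicy) (h : ℕ) :
    ∀ hh : h < H, ∀ s, (s, ⟨h, hh⟩) ∈ X → value p π' r h s = optVal (expect p) r h s := by
  refine backward_induction (H := H) (P := fun h => ∀ hh : h < H, ∀ s, (s, ⟨h, hh⟩) ∈ X →
    value p π' r h s = optVal (expect p) r h s) ?_ ?_ h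
  · intro h hh hh'
    omega
  · intro h hh ih _ s hs
    rw [value_of_eq_vertex (h := ⟨h, hh⟩) (hπ' s _ hs),
      optVal_eq_of_forall_le (h := ⟨h, hh⟩) (hr s _ hs), qValue_eq, optQ]
    congr 1
    refine hX.expect_congr hs (fun hh' s' hs' => ih hh' s' hs') fun hh' => ?_
    rw [optVal_of_le _ _ (by simpa using hh'), value_of_le _ _ _ (by simpa using hh')]

/-- The quantifier over continuations outside `X` is tested on the greedy continuation, whose value
is the optimal one. Conversely, closedness makes what is played outside `X` irrelevant to the value
of the prescribed actions, while it can only lower the Q-value of the other actions. -/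
theorem feasibleOn_eq_greedyOn [Nonempty A] {X : Set (S × Fin H)} {p : Transition S A H}
    {π : DetPolicy S A H} (hX : IsClosedUnder X p π) :
    feasibleOn X p π = greedyOn X (expect p) π := by
  classical
  refine Set.Subset.antisymm (fun r hr => ?_) fun r hr π' hπ' s h hs a => ?_
  · choose g hg using exists_greedy (expect p) r
    set π' : Policy S A H := fun h s =>
      if (s, h) ∈ X then π.toPolicy h s else stdSimplex.vertex (g h s) with hπ'def
    have hπ' : π' ∈ policyClass X π.toPolicy := fun s h hs => by simp only [hπ'def, if_pos hs]
    have hval : ∀ h, value p π' r h = optVal (expect p) r h := by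
      refine backward_induction (H := H) ?_ ?_
      · intro h hh
        rw [optVal_of_le _ _ hh, value_of_le _ _ _ hh]
      · intro h hh ih
        have hq : ∀ s a, qValue p π' r ⟨h, hh⟩ s a = optQ (expect p) r ⟨h, hh⟩ s a := by
          intro s a
          rw [qValue_eq, optQ, ih]
        funext s
        by_cases hs : (s, (⟨h, hh⟩ : Fin H)) ∈ X
        · rw [value_of_eq_vertex (h := ⟨h, hh⟩) (hπ' s _ hs),
            optVal_eq_of_forall_le (h := ⟨h, hh⟩) (a := π ⟨h, hh⟩ s), hq]
          intro b
          rw [← hq, ← hq]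
          exact hr π' hπ' s _ hs b
        · rw [value_of_eq_vertex (h := ⟨h, hh⟩) (a := g ⟨h, hh⟩ s)
            (by simp only [hπ'def, if_neg hs]),
            optVal_eq_of_forall_le (h := ⟨h, hh⟩) (hg ⟨h, hh⟩ s), hq]
    intro s h hs a
    have := hr π' hπ' s h hs a
    simp only [qValue_eq, hval] at this
    exact this
  · have heq : qValue p π' r h s (π h s) = optQ (expect p) r h s (π h s) := by
      rw [← value_of_eq_vertex (hπ' s h hs), ← optVal_eq_of_forall_le (hr s h hs)]
      exact value_eq_optVal_of_greedyOn hX hr hπ' h h.isLt s hs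
    rw [heq]
    exact (qValue_le_optQ p π' r h s a).trans (hr s h hs a)

/-- For rewards that make `π` optimistically greedy on a closed set, the optimistic optimal value
is attained there in every compatible model. -/
theorem greedyOn_expect_of_optimistic [Nonempty A] {X : Set (S × Fin H)}
    {Z : Set (S × A × Fin H)} {p p' : Transition S A H} {π : DetPolicy S A H}
    (hX : IsClosedUnder X p π) (hXZ : ∀ s h, (s, h) ∈ X → (s, π h s, h) ∈ Z)
    (hp : p' ∈ transitionClass Z p) {r : Reward S A H}
    (hr : r ∈ greedyOn X (optimistic Z p) π) : r ∈ greedyOn X (expect p') π := by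
  have hT : ∀ s h, (s, h) ∈ X → ∀ v, optimistic Z p h s (π h s) v = expect p h s (π h s) v := by
    intro s h hs v
    rw [optimistic, if_pos (hXZ s h hs)]
  have hE : ∀ s h, (s, h) ∈ X → ∀ v, expect p' h s (π h s) v = expect p h s (π h s) v := by
    intro s h hs v
    rw [expect, expect, hp _ _ _ (hXZ s h hs)]
  -- Optimism dominates everywhere; on `X` the two values coincide, since the prescribed actions
  -- stay in `X` and use only rows in `Z`. Deviations thus gain at most what they gain
  -- optimistically.
  have hle : ∀ h, optVal (expect p') r h ≤ optVal (optimistic Z p) r h :=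
    optVal_le_optVal (expect_le_optimistic hp) r (optimistic_mono Z p)
  have hval : ∀ h, ∀ hh : h < H, ∀ s, (s, ⟨h, hh⟩) ∈ X →
      optVal (expect p') r h s = optVal (optimistic Z p) r h s ∧
      optQ (expect p') r ⟨h, hh⟩ s (π ⟨h, hh⟩ s) =
        optQ (optimistic Z p) r ⟨h, hh⟩ s (π ⟨h, hh⟩ s) := by
    refine backward_induction (H := H) ?_ ?_
    · intro h hh hh'
      omega
    · intro h hh ih _ s hs
      have hq : optQ (expect p') r ⟨h, hh⟩ s (π ⟨h, hh⟩ s) =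
          optQ (optimistic Z p) r ⟨h, hh⟩ s (π ⟨h, hh⟩ s) := by
        rw [optQ, optQ, hT s _ hs, hE s _ hs]
        congr 1
        refine hX.expect_congr hs (fun hh' s' hs' => (ih hh' s' hs').1) fun hh' => ?_
        rw [optVal_of_le _ _ (by simpa using hh'), optVal_of_le _ _ (by simpa using hh')]
      refine ⟨le_antisymm (hle h s) ?_, hq⟩
      rw [optVal_eq_of_forall_le (h := ⟨h, hh⟩) (hr s _ hs), ← hq]
      exact optQ_le_optVal _ r ⟨h, hh⟩ s _
  intro s h hs a
  calc optQ (expect p') r h s a ≤ optQ (optimistic Z p) r h s a :=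
        add_le_add le_rfl ((expect_mono p' _ _ _ (hle _)).trans (expect_le_optimistic hp _ _ _ _))
    _ ≤ optQ (optimistic Z p) r h s (π h s) := hr s h hs a
    _ = optQ (expect p') r h s (π h s) := (hval h h.isLt s hs).2.symm

/-- One model attains the optimistic values simultaneously: the best next state depends only on the
stage, so every row outside `Z` can be a point mass there. -/
theorem exists_optimistic_model [DecidableEq S] [Nonempty S] (Z : Set (S × A × Fin H))
    (p : Transition S A H) (r : Reward S A H) :
    ∃ p' ∈ transitionClass Z p, optQ (expect p') r = optQ (optimistic Z p) r := by
  classical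
  have hmax : ∀ h : Fin H, ∃ s', ∀ x, optVal (optimistic Z p) r (h.val + 1) x ≤
      optVal (optimistic Z p) r (h.val + 1) s' := fun h => Finite.exists_max _
  choose m hm using hmax
  refine ⟨fun h s a => if (s, a, h) ∈ Z then p h s a else stdSimplex.vertex (m h), ?_, ?_⟩
  · intro s a h hz
    simp only [if_pos hz]
  · refine optQ_transfer fun h s a => ?_
    rw [optQ]
    congr 1
    by_cases hz : (s, a, h) ∈ Z
    · simp only [expect, optimistic, if_pos hz]
    · simp only [expect, optimistic, if_neg hz, vertex_apply, ite_mul, one_mul, zero_mul,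
        Finset.sum_ite_eq', Finset.mem_univ, if_true]
      exact le_antisymm (le_ciSup (f := optVal (optimistic Z p) r (h.val + 1))
        (Set.finite_range _).bddAbove (m h)) (ciSup_le (hm h))

theorem IsClosedUnder.of_mem_transitionClass {X : Set (S × Fin H)} {Z : Set (S × A × Fin H)}
    {p p' : Transition S A H} {π : DetPolicy S A H} (hX : IsClosedUnder X p π)
    (hXZ : ∀ s h, (s, h) ∈ X → (s, π h s, h) ∈ Z) (hp : p' ∈ transitionClass Z p) :
    IsClosedUnder X p' π := by
  intro s h h' hh hs s' h0
  rw [hp _ _ _ (hXZ s h hs)] at h0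
  exact hX s h h' hh hs s' h0

theorem iInter_feasibleOn_eq_greedyOn [Nonempty A] [DecidableEq S] [Nonempty S]
    {X : Set (S × Fin H)} {Z : Set (S × A × Fin H)} {p : Transition S A H} {π : DetPolicy S A H}
    (hX : IsClosedUnder X p π) (hXZ : ∀ s h, (s, h) ∈ X → (s, π h s, h) ∈ Z) :
    ⋂ p' ∈ transitionClass Z p, feasibleOn X p' π = greedyOn X (optimistic Z p) π := by
  refine Set.Subset.antisymm (fun r hr => ?_) fun r hr => ?_
  · obtain ⟨p', hp', hq⟩ := exists_optimistic_model Z p r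
    have := Set.mem_iInter₂.1 hr p' hp'
    rw [feasibleOn_eq_greedyOn (hX.of_mem_transitionClass hXZ hp')] at this
    intro s h hs a
    rw [← hq]
    exact this s h hs a
  · refine Set.mem_iInter₂.2 fun p' hp' => ?_
    rw [feasibleOn_eq_greedyOn (hX.of_mem_transitionClass hXZ hp')]
    exact greedyOn_expect_of_optimistic hX hXZ hp' hr

/-! ### Moving rewards between transition models -/

/-- The rewards `r` and `r'` differ on `Z` by at most the effect on values bounded by
`H * M` of moving from `p` to `q`, and they coincide elsewhere. -/
def IsClose (Z : Set (S × A × Fin H)) (p q : Transition S A H) (M : ℝ) (r r' : Reward S A H) :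
    Prop :=
  (∀ s a h, (s, a, h) ∈ Z → |r h s a - r' h s a| ≤ H * M * ∑ s', |p h s a s' - q h s a s'|) ∧
    ∀ s a h, (s, a, h) ∉ Z → r h s a = r' h s a

theorem abs_expect_sub_le {p q : Transition S A H} {h : Fin H} {s : S} {a : A} {v : S → ℝ}
    {B : ℝ} (hv : ∀ s', |v s'| ≤ B) :
    |expect p h s a v - expect q h s a v| ≤ B * ∑ s', |p h s a s' - q h s a s'| := by
  rw [expect, expect, ← Finset.sum_sub_distrib, Finset.mul_sum]
  refine (Finset.abs_sum_le_sum_abs _ _).trans (Finset.sum_le_sum fun s' _ => ?_)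
  rw [← sub_mul, abs_mul, mul_comm]
  exact mul_le_mul_of_nonneg_right (hv s') (abs_nonneg _)

/-- The reward is chosen to keep the whole optimal Q-function, hence greediness, and absorbs the
change of operator at the old optimal values. Stating this for abstract operators serves the
intersection (optimistic operators) and the union (expectations) at once. -/
theorem exists_isClose_of_lookahead [Nonempty A] {X : Set (S × Fin H)} {Z : Set (S × A × Fin H)}
    {p q : Transition S A H} {π : DetPolicy S A H} {T T' : Lookahead S A H}
    (hT : ∀ h s a v B, (∀ s', |v s'| ≤ B) → |T h s a v| ≤ B)
    (hTp : ∀ s a h, (s, a, h) ∈ Z → T h s a = expect p h s a)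
    (hTq : ∀ s a h, (s, a, h) ∈ Z → T' h s a = expect q h s a)
    (hTT : ∀ s a h, (s, a, h) ∉ Z → T h s a = T' h s a)
    {r : Reward S A H} (hr : r ∈ greedyOn X T π) :
    ∃ r' ∈ greedyOn X T' π, IsClose Z p q ‖r‖ r r' := by
  set r' : Reward S A H := fun h s a =>
    optQ T r h s a - T' h s a (optVal T r (h.val + 1)) with hr'
  have hQ : optQ T' r' = optQ T r := optQ_transfer fun h s a => by simp only [hr']; ring
  have hd : ∀ h s a, r h s a - r' h s a =
      T' h s a (optVal T r (h.val + 1)) - T h s a (optVal T r (h.val + 1)) := by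
    intro h s a
    simp only [hr', optQ]
    ring
  refine ⟨r', ?_, ?_, ?_⟩
  · intro s h hs a
    rw [hQ]
    exact hr s h hs a
  · intro s a h hz
    rw [hd, hTp _ _ _ hz, hTq _ _ _ hz, abs_sub_comm]
    exact abs_expect_sub_le fun s' => abs_optVal_le hT r _ s'
  · intro s a h hz
    rw [← sub_eq_zero, hd, hTT _ _ _ hz, sub_self]

theorem exists_isClose_iInter [Nonempty A] [DecidableEq S] [Nonempty S] {X : Set (S × Fin H)}
    {Z : Set (S × A × Fin H)} {p q : Transition S A H} {π : DetPolicy S A H}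
    (hXp : IsClosedUnder X p π) (hXq : IsClosedUnder X q π)
    (hXZ : ∀ s h, (s, h) ∈ X → (s, π h s, h) ∈ Z) {r : Reward S A H}
    (hr : r ∈ ⋂ p' ∈ transitionClass Z p, feasibleOn X p' π) :
    ∃ r' ∈ ⋂ p' ∈ transitionClass Z q, feasibleOn X p' π, IsClose Z p q ‖r‖ r r' := by
  rw [iInter_feasibleOn_eq_greedyOn hXp hXZ] at hr
  rw [iInter_feasibleOn_eq_greedyOn hXq hXZ]
  refine exists_isClose_of_lookahead (fun h s a v B => abs_optimistic_le Z p h s a) ?_ ?_ ?_ hr <;>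
  · intro s a h hz
    funext v
    simp only [optimistic, hz, if_true, if_false]

theorem exists_isClose_iUnion [Nonempty A] {X : Set (S × Fin H)}
    {Z : Set (S × A × Fin H)} {p q : Transition S A H} {π : DetPolicy S A H}
    (hXp : IsClosedUnder X p π) (hXq : IsClosedUnder X q π)
    (hXZ : ∀ s h, (s, h) ∈ X → (s, π h s, h) ∈ Z) {r : Reward S A H}
    (hr : r ∈ ⋃ p' ∈ transitionClass Z p, feasibleOn X p' π) :
    ∃ r' ∈ ⋃ p' ∈ transitionClass Z q, feasibleOn X p' π, IsClose Z p q ‖r‖ r r' := by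
  classical
  obtain ⟨p', hp', hr⟩ := Set.mem_iUnion₂.1 hr
  -- The witness model keeps the unobserved rows of `p'`, so that the reward is not altered outside
  -- `Z`.
  set q' : Transition S A H := fun h s a => if (s, a, h) ∈ Z then q h s a else p' h s a with hq'def
  have hq' : q' ∈ transitionClass Z q := fun s a h hz => by simp only [hq'def, if_pos hz]
  rw [feasibleOn_eq_greedyOn (hXp.of_mem_transitionClass hXZ hp')] at hr
  obtain ⟨r', hr', hc⟩ := exists_isClose_of_lookahead (T' := expect q') (p := p) (q := q) (Z := Z)
    (fun h s a v B => abs_expect_le p' h s a)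
    (fun s a h hz => by funext v; rw [expect, expect, hp' _ _ _ hz])
    (fun s a h hz => by funext v; rw [expect, expect, hq' _ _ _ hz])
    (fun s a h hz => by funext v; simp only [expect, hq'def, if_neg hz]) hr
  refine ⟨r', Set.mem_iUnion₂.2 ⟨q', hq', ?_⟩, hc⟩
  rw [feasibleOn_eq_greedyOn (hXq.of_mem_transitionClass hXZ hq')]
  exact hr'

/-! ### Irrelevance of the last transition -/

theorem value_congr {p p' : Transition S A H}
    (hp : ∀ h : Fin H, h.val + 1 < H → p' h = p h) (π : Policy S A H) (r : Reward S A H) (h : ℕ) :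
    value p' π r h = value p π r h := by
  refine backward_induction (H := H) (P := fun h => value p' π r h = value p π r h) ?_ ?_ h
  · intro h hh
    rw [value_of_le _ _ _ hh, value_of_le _ _ _ hh]
  · intro h hh ih
    funext s
    rw [value_eq_sum _ _ _ ⟨h, hh⟩, value_eq_sum _ _ _ ⟨h, hh⟩]
    refine Finset.sum_congr rfl fun a _ => ?_
    rw [qValue_eq, qValue_eq, ih]
    by_cases h1 : h + 1 < H
    · rw [expect, expect, hp ⟨h, hh⟩ h1]
    · rw [value_of_le _ _ _ (by simpa using h1)]
      simp [expect]

theorem feasibleOn_congr {p p' : Transition S A H}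
    (hp : ∀ h : Fin H, h.val + 1 < H → p' h = p h) (X : Set (S × Fin H)) (π : DetPolicy S A H) :
    feasibleOn X p' π = feasibleOn X p π := by
  have hq : ∀ π' r, qValue p' π' r = qValue p π' r := by
    intro π' r
    funext h s a
    rw [qValue_eq, qValue_eq, value_congr hp]
    by_cases h1 : h.val + 1 < H
    · rw [expect, expect, hp h h1]
    · rw [value_of_le _ _ _ (by simpa using h1)]
      simp [expect]
  simp only [feasibleOn, hq]

theorem feasibleOn_congr_policy {X : Set (S × Fin H)} {π π' : DetPolicy S A H}
    (hπ : ∀ s h, (s, h) ∈ X → π' h s = π h s) (p : Transition S A H) :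
    feasibleOn X p π' = feasibleOn X p π := by
  have hc : policyClass X π'.toPolicy = policyClass X π.toPolicy := by
    ext π''
    refine forall_congr' fun s => forall_congr' fun h => forall_congr' fun hs => ?_
    rw [DetPolicy.toPolicy, DetPolicy.toPolicy, hπ s h hs]
  ext r
  simp only [feasibleOn, hc, Set.mem_ofPred_eq]
  refine forall_congr' fun π'' => forall_congr' fun _ => forall_congr' fun s =>
    forall_congr' fun h => forall_congr' fun hs => forall_congr' fun a => ?_
  rw [hπ s h hs]

end Bellman

/-! ### Sums of causal products over finite sequences -/

section Causal

variable {X : Type*} [Fintype X] {H : ℕ}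

/-- Exchanging coordinate `k` with the extra letter is an involution of the pairs, so resampling a
coordinate only multiplies the sum by the number of letters. -/
theorem sum_sum_update (G : (Fin H → X) → ℝ) (k : Fin H) :
    ∑ ω : Fin H → X, ∑ x, G (Function.update ω k x) = Fintype.card X * ∑ ω, G ω := by
  let e : (Fin H → X) × X ≃ (Fin H → X) × X :=
    { toFun := fun y => (Function.update y.1 k y.2, y.1 k)
      invFun := fun y => (Function.update y.1 k y.2, y.1 k)
      left_inv := fun y => by simp
      right_inv := fun y => by simp }
  have he := Fintype.sum_equiv e (fun y => G (Function.update y.1 k y.2)) (fun y => G y.1)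
    fun y => rfl
  rw [Fintype.sum_prod_type, Fintype.sum_prod_type] at he
  rw [he, Finset.mul_sum]
  simp

/-- The product of the first `k` factors. -/
def headProd (φ : Fin H → (Fin H → X) → ℝ) (k : ℕ) (ω : Fin H → X) : ℝ :=
  ∏ h : Fin H, if h.val < k then φ h ω else 1

variable {φ : Fin H → (Fin H → X) → ℝ}

theorem headProd_succ (k : Fin H) (ω : Fin H → X) :
    headProd φ (k.val + 1) ω = headProd φ k ω * φ k ω := by
  have hk : φ k ω = ∏ h : Fin H, if h = k then φ h ω else 1 := by simp
  rw [headProd, headProd, hk, ← Finset.prod_mul_distrib]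
  refine Finset.prod_congr rfl fun h _ => ?_
  rcases lt_trichotomy h k with hlt | rfl | hgt
  · have : h.val < k.val := hlt
    simp [hlt.ne, this, this.trans (Nat.lt_succ_self _)]
  · simp
  · have : k.val < h.val := hgt
    simp [hgt.ne', show ¬ h.val < k.val + 1 by omega, show ¬ h.val < k.val by omega]

theorem headProd_full (ω : Fin H → X) : headProd φ H ω = ∏ h, φ h ω := by
  simp [headProd]

theorem sum_headProd_succ
    (hφ : ∀ (h k : Fin H) ω x, h < k → φ h (Function.update ω k x) = φ h ω)
    (k : Fin H) (F : (Fin H → X) → ℝ) :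
    Fintype.card X * ∑ ω, headProd φ (k.val + 1) ω * F ω =
      ∑ ω, headProd φ k ω * ∑ x, φ k (Function.update ω k x) * F (Function.update ω k x) := by
  rw [← sum_sum_update _ k]
  refine Finset.sum_congr rfl fun ω _ => ?_
  rw [Finset.mul_sum]
  refine Finset.sum_congr rfl fun x _ => ?_
  have : headProd φ k (Function.update ω k x) = headProd φ k ω := by
    refine Finset.prod_congr rfl fun h _ => ?_
    split_ifs with hh
    · exact hφ h k ω x hh
    · rfl
  rw [headProd_succ, this, mul_assoc]

/-- Stages are summed out from the last one backwards: earlier factors do not see the stage, and its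
own factor sums to one. Sequences always keep all `H` coordinates, so each dropped factor leaves a
free coordinate, which accounts for the power of the cardinality. -/
theorem sum_headProd_of_le
    (hφ : ∀ (h k : Fin H) ω x, h < k → φ h (Function.update ω k x) = φ h ω)
    (hsum : ∀ (k : Fin H) ω, ∑ x, φ k (Function.update ω k x) = 1)
    {m n : ℕ} (hmn : m ≤ n) (hn : n ≤ H) {F : (Fin H → X) → ℝ}
    (hF : ∀ (k : Fin H) ω x, m ≤ k.val → F (Function.update ω k x) = F ω) :
    (Fintype.card X : ℝ) ^ (n - m) * ∑ ω, headProd φ n ω * F ω = ∑ ω, headProd φ m ω * F ω := by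
  induction n, hmn using Nat.le_induction with
  | base => simp
  | succ n hmn ih =>
    rw [← ih (by omega), Nat.succ_sub hmn, pow_succ, mul_assoc,
      sum_headProd_succ hφ ⟨n, hn⟩]
    congr 1
    refine Finset.sum_congr rfl fun ω _ => ?_
    simp only [hF ⟨n, hn⟩ ω _ hmn, ← Finset.sum_mul, hsum, one_mul]

end Causal

/-! ### Laws of trajectories -/

section Trajectories

variable {S A : Type*} [Fintype S] [Fintype A] [DecidableEq S] [DecidableEq A] {H : ℕ}
  (μ₀ : stdSimplex ℝ S) (p : Transition S A H) (π : Policy S A H)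

/-- The law of the state at stage `h` given the preceding stage of `ω`. -/
def stateLaw (ω : Traj S A H) (h : Fin H) : stdSimplex ℝ S :=
  if h.val = 0 then μ₀
  else
    let g : Fin H := ⟨h.val - 1, lt_of_le_of_lt (Nat.sub_le _ _) h.isLt⟩
    p g (ω g).1 (ω g).2

theorem stateWeight_eq (ω : Traj S A H) (h : Fin H) :
    stateWeight μ₀ p ω h = stateLaw μ₀ p ω h (ω h).1 := by
  unfold stateWeight stateLaw
  split_ifs <;> rfl

theorem stateLaw_succ (ω : Traj S A H) (h : Fin H) (hh : h.val + 1 < H) :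
    stateLaw μ₀ p ω ⟨h.val + 1, hh⟩ = p h (ω h).1 (ω h).2 := by
  simp [stateLaw]

/-- The factor of the probability of `ω` that belongs to stage `h`. -/
def stageWeight (h : Fin H) (ω : Traj S A H) : ℝ :=
  stateWeight μ₀ p ω h * π h (ω h).1 (ω h).2

theorem stageWeight_nonneg (h : Fin H) (ω : Traj S A H) : 0 ≤ stageWeight μ₀ p π h ω := by
  rw [stageWeight, stateWeight_eq]
  exact mul_nonneg (stdSimplex.zero_le _ _) (stdSimplex.zero_le _ _)

theorem trajProb_nonneg (ω : Traj S A H) : 0 ≤ trajProb μ₀ p π ω :=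
  Finset.prod_nonneg fun h _ => stageWeight_nonneg μ₀ p π h ω

theorem stageWeight_update_of_lt (h k : Fin H) (ω : Traj S A H) (x : S × A) (hk : h < k) :
    stageWeight μ₀ p π h (Function.update ω k x) = stageWeight μ₀ p π h ω := by
  have hk' : h.val < k.val := hk
  have h1 : (⟨h.val - 1, lt_of_le_of_lt (Nat.sub_le _ _) h.isLt⟩ : Fin H) ≠ k := by
    intro he
    have := congrArg Fin.val he
    simp only at this
    omega
  simp only [stageWeight, stateWeight, Function.update_of_ne hk.ne, Function.update_of_ne h1]

theorem sum_stageWeight_update (k : Fin H) (ω : Traj S A H) (g : S → ℝ) :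
    ∑ x : S × A, stageWeight μ₀ p π k (Function.update ω k x) * g x.1 =
      ∑ s, stateLaw μ₀ p ω k s * g s := by
  have hlaw : ∀ x, stateLaw μ₀ p (Function.update ω k x) k = stateLaw μ₀ p ω k := by
    intro x
    unfold stateLaw
    split_ifs with h0
    · rfl
    · have h1 : (⟨k.val - 1, lt_of_le_of_lt (Nat.sub_le _ _) k.isLt⟩ : Fin H) ≠ k := by
        intro he
        have := congrArg Fin.val he
        simp only at this
        omega
      simp only [Function.update_of_ne h1]
  rw [Fintype.sum_prod_type]
  refine Finset.sum_congr rfl fun s _ => ?_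
  have : ∀ a, stageWeight μ₀ p π k (Function.update ω k (s, a)) * g (s, a).1 =
      π k s a * (stateLaw μ₀ p ω k s * g s) := by
    intro a
    rw [stageWeight, stateWeight_eq, hlaw]
    simp only [Function.update_self]
    ring
  rw [Finset.sum_congr rfl fun a _ => this a, ← Finset.sum_mul, stdSimplex.sum_eq_one, one_mul]

theorem sum_stageWeight_update_one (k : Fin H) (ω : Traj S A H) :
    ∑ x : S × A, stageWeight μ₀ p π k (Function.update ω k x) = 1 := by
  simpa using sum_stageWeight_update μ₀ p π k ω fun _ => 1

theorem trajProb_eq (ω : Traj S A H) :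
    trajProb μ₀ p π ω = headProd (stageWeight μ₀ p π) H ω := by
  rw [headProd_full]
  rfl

theorem sum_trajProb [Nonempty S] [Nonempty A] : ∑ ω, trajProb μ₀ p π ω = 1 := by
  have h := sum_headProd_of_le (stageWeight_update_of_lt μ₀ p π)
    (sum_stageWeight_update_one μ₀ p π) (Nat.zero_le H) le_rfl (F := fun _ => 1)
    fun _ _ _ _ => rfl
  simp only [mul_one, ← trajProb_eq] at h
  have hc : (Fintype.card (S × A) : ℝ) ^ H ≠ 0 := by
    have : 0 < Fintype.card (S × A) := Fintype.card_pos
    positivity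
  have h0 : ∑ ω : Traj S A H, headProd (stageWeight μ₀ p π) 0 ω =
      (Fintype.card (S × A) : ℝ) ^ H := by
    simp [headProd]
  rw [h0, Nat.sub_zero] at h
  exact mul_left_cancel₀ hc (h.trans (mul_one _).symm)

/-- The Markov property at stage `h`. -/
theorem sum_trajProb_next [Nonempty S] [Nonempty A] (h : Fin H) (hh : h.val + 1 < H) (s : S)
    (a : A) (g : S → ℝ) :
    ∑ ω, trajProb μ₀ p π ω * (if ω h = (s, a) then g (ω ⟨h.val + 1, hh⟩).1 else 0) =
      visitSA μ₀ p π h s a * ∑ s', p h s a s' * g s' := by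
  set k : Fin H := ⟨h.val + 1, hh⟩ with hk
  set c : ℝ := ((Fintype.card (S × A) : ℕ) : ℝ) with hc
  have hc0 : c ≠ 0 := by
    have : 0 < Fintype.card (S × A) := Fintype.card_pos
    positivity
  have hne : h ≠ k := by
    intro he
    have := congrArg Fin.val he
    simp [hk] at this
  have e1 := sum_headProd_of_le (stageWeight_update_of_lt μ₀ p π)
    (sum_stageWeight_update_one μ₀ p π) (m := k.val + 1) (n := H) k.isLt le_rfl
    (F := fun ω => if ω h = (s, a) then g (ω k).1 else 0) (by
      intro j ω x hj
      have hj1 : h ≠ j := by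
        rintro rfl
        simp [hk] at hj
      have hj2 : k ≠ j := by
        rintro rfl
        omega
      simp only [Function.update_of_ne hj1, Function.update_of_ne hj2])
  -- Stage `h + 1` is summed by hand: its factor turns `g` into its mean under `p h s a`. The later
  -- stages integrate to one (`e1`), and `e3` recognizes what remains as the visitation probability.
  have e2 := sum_headProd_succ (stageWeight_update_of_lt μ₀ p π) k
    (fun ω => if ω h = (s, a) then g (ω k).1 else 0)
  have e3 := sum_headProd_of_le (stageWeight_update_of_lt μ₀ p π)
    (sum_stageWeight_update_one μ₀ p π) (m := k.val) (n := H) k.isLt.le le_rfl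
    (F := fun ω => if ω h = (s, a) then (1 : ℝ) else 0) (by
      intro j ω x hj
      have hj1 : h ≠ j := by
        rintro rfl
        simp [hk] at hj
      simp only [Function.update_of_ne hj1])
  have e4 : ∀ ω : Traj S A H, ∑ x, stageWeight μ₀ p π k (Function.update ω k x) *
      (if Function.update ω k x h = (s, a) then g (Function.update ω k x k).1 else 0) =
      (if ω h = (s, a) then (1 : ℝ) else 0) * ∑ s', p h s a s' * g s' := by
    intro ω
    simp only [Function.update_of_ne hne, Function.update_self]
    split_ifs with hω
    · rw [sum_stageWeight_update, hk, stateLaw_succ, hω, one_mul]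
    · simp
  simp only [e4, ← mul_assoc, ← Finset.sum_mul] at e2
  rw [← e3] at e2
  rw [← hc] at e1 e2
  simp only [← trajProb_eq] at e1 e2
  have hpow : c ^ (H - k.val) = c * c ^ (H - (k.val + 1)) := by
    rw [← pow_succ']
    congr 1
    have := k.isLt
    omega
  rw [← e1, hpow] at e2
  have hv : visitSA μ₀ p π h s a =
      ∑ ω, trajProb μ₀ p π ω * (if ω h = (s, a) then 1 else 0) := by
    simp [visitSA]
  rw [hv]
  have hc1 : c * c ^ (H - (k.val + 1)) ≠ 0 := by positivity
  refine mul_left_cancel₀ hc1 ?_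
  linear_combination e2

theorem visitSA_nonneg (h : Fin H) (s : S) (a : A) : 0 ≤ visitSA μ₀ p π h s a :=
  Finset.sum_nonneg fun ω _ => by
    split_ifs
    · exact trajProb_nonneg μ₀ p π ω
    · exact le_rfl

theorem sum_visitSA [Nonempty S] [Nonempty A] (h : Fin H) :
    ∑ s, ∑ a, visitSA μ₀ p π h s a = 1 := by
  rw [← Fintype.sum_prod_type' (f := fun s a => visitSA μ₀ p π h s a), ← sum_trajProb μ₀ p π]
  simp only [visitSA]
  rw [Finset.sum_comm]
  simp

variable {μ₀ p π}

theorem mem_suppSA_iff {h : Fin H} {s : S} {a : A} :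
    (s, a, h) ∈ suppSA μ₀ p π ↔ ∃ ω, 0 < trajProb μ₀ p π ω ∧ ω h = (s, a) := by
  change 0 < visitSA μ₀ p π h s a ↔ _
  rw [visitSA, Finset.sum_pos_iff_of_nonneg]
  · refine exists_congr fun ω => ?_
    by_cases hω : ω h = (s, a) <;> simp [hω]
  · intro ω _
    split_ifs
    · exact trajProb_nonneg μ₀ p π ω
    · exact le_rfl

theorem mem_suppS_iff {h : Fin H} {s : S} :
    (s, h) ∈ suppS μ₀ p π ↔ ∃ ω, 0 < trajProb μ₀ p π ω ∧ (ω h).1 = s := by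
  change 0 < ∑ a, visitSA μ₀ p π h s a ↔ _
  rw [Finset.sum_pos_iff_of_nonneg fun a _ => visitSA_nonneg μ₀ p π h s a]
  constructor
  · rintro ⟨a, -, ha⟩
    obtain ⟨ω, h1, h2⟩ := mem_suppSA_iff.1 (show (s, a, h) ∈ suppSA μ₀ p π from ha)
    exact ⟨ω, h1, by rw [h2]⟩
  · rintro ⟨ω, h1, rfl⟩
    exact ⟨(ω h).2, Finset.mem_univ _, mem_suppSA_iff.2 ⟨ω, h1, rfl⟩⟩

theorem trajProb_pos_iff {ω : Traj S A H} : 0 < trajProb μ₀ p π ω ↔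
    ∀ h, 0 < stateLaw μ₀ p ω h (ω h).1 ∧ 0 < π h (ω h).1 (ω h).2 := by
  have hf : ∀ h, stageWeight μ₀ p π h ω = stateLaw μ₀ p ω h (ω h).1 * π h (ω h).1 (ω h).2 :=
    fun h => by rw [stageWeight, stateWeight_eq]
  constructor
  · intro hω h
    have h0 : stageWeight μ₀ p π h ω ≠ 0 := fun h0 =>
      hω.ne' (Finset.prod_eq_zero (Finset.mem_univ h) h0)
    rw [hf] at h0
    exact ⟨(stdSimplex.zero_le _ _).lt_of_ne' (left_ne_zero_of_mul h0),
      (stdSimplex.zero_le _ _).lt_of_ne' (right_ne_zero_of_mul h0)⟩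
  · intro hω
    refine Finset.prod_pos fun h _ => ?_
    change 0 < stageWeight μ₀ p π h ω
    rw [hf]
    exact mul_pos (hω h).1 (hω h).2

theorem trajProb_pos_next {ω : Traj S A H} (hω : 0 < trajProb μ₀ p π ω) (h : Fin H)
    (hh : h.val + 1 < H) : 0 < p h (ω h).1 (ω h).2 (ω ⟨h.val + 1, hh⟩).1 := by
  have := (trajProb_pos_iff.1 hω ⟨h.val + 1, hh⟩).1
  rwa [stateLaw_succ] at this

theorem suppS_next [Nonempty S] [Nonempty A] {h h' : Fin H} (hh : h'.val = h.val + 1) {s s' : S}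
    {a : A} (hz : (s, a, h) ∈ suppSA μ₀ p π) (hs' : 0 < p h s a s') :
    (s', h') ∈ suppS μ₀ p π := by
  have h1 : h.val + 1 < H := hh ▸ h'.isLt
  obtain rfl : h' = ⟨h.val + 1, h1⟩ := Fin.ext hh
  have hsum := sum_trajProb_next μ₀ p π h h1 s a fun x => if x = s' then 1 else 0
  have hpos : 0 < visitSA μ₀ p π h s a * ∑ x, p h s a x * (if x = s' then 1 else 0) := by
    simpa using mul_pos hz hs'
  rw [← hsum] at hpos
  obtain ⟨ω, -, hω⟩ := Finset.exists_lt_of_sum_lt (f := fun _ => (0 : ℝ))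
    (Finset.sum_const_zero.trans_lt hpos)
  refine mem_suppS_iff.2 ⟨ω, ?_, ?_⟩
  · exact (trajProb_nonneg μ₀ p π ω).lt_of_ne' (left_ne_zero_of_mul hω.ne')
  · by_contra hne
    simp [hne] at hω

/-- Summing out every later stage leaves the initial law as the marginal of the first state. -/
theorem suppS_zero [Nonempty S] [Nonempty A] {h : Fin H} (hh : h.val = 0) {s : S} :
    0 < μ₀ s → (s, h) ∈ suppS μ₀ p π := by
  intro hs
  have e1 := sum_headProd_of_le (stageWeight_update_of_lt μ₀ p π)
    (sum_stageWeight_update_one μ₀ p π) (m := h.val + 1) (n := H) h.isLt le_rfl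
    (F := fun ω => if (ω h).1 = s then 1 else 0) (by
      intro j ω x hj
      have hj1 : h ≠ j := by
        rintro rfl
        omega
      simp only [Function.update_of_ne hj1])
  have e2 := sum_headProd_succ (stageWeight_update_of_lt μ₀ p π) h
    (fun ω => if (ω h).1 = s then 1 else 0)
  have e3 : ∀ ω : Traj S A H, ∑ x, stageWeight μ₀ p π h (Function.update ω h x) *
      (if (Function.update ω h x h).1 = s then 1 else 0) = μ₀ s := by
    intro ω
    simp only [Function.update_self]
    rw [sum_stageWeight_update μ₀ p π h ω fun y => if y = s then 1 else 0, stateLaw, if_pos hh]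
    simp
  simp only [e3] at e2
  have e4 : ∀ ω : Traj S A H, headProd (stageWeight μ₀ p π) h.val ω = 1 := by
    intro ω
    simp [headProd, hh]
  simp only [e4, one_mul] at e2
  have hc : 0 < Fintype.card (S × A) := Fintype.card_pos
  have hpos : 0 < ∑ _ω : Traj S A H, μ₀ s :=
    Finset.sum_pos (fun _ _ => hs) Finset.univ_nonempty
  rw [← e2, ← e1] at hpos
  have hpos' : 0 < ∑ ω, headProd (stageWeight μ₀ p π) H ω * (if (ω h).1 = s then 1 else 0) := by
    refine pos_of_mul_pos_right (pos_of_mul_pos_right hpos ?_) ?_ <;> positivity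
  obtain ⟨ω, -, hω⟩ := Finset.exists_lt_of_sum_lt (f := fun _ => (0 : ℝ))
    (Finset.sum_const_zero.trans_lt hpos')
  rw [← trajProb_eq] at hω
  refine mem_suppS_iff.2 ⟨ω, ?_, ?_⟩
  · exact (trajProb_nonneg μ₀ p π ω).lt_of_ne' (left_ne_zero_of_mul hω.ne')
  · by_contra hne
    simp [hne] at hω

theorem action_eq_of_trajProb_pos {π : DetPolicy S A H} {ω : Traj S A H}
    (hω : 0 < trajProb μ₀ p π.toPolicy ω) (h : Fin H) : (ω h).2 = π h (ω h).1 := by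
  by_contra hne
  have := (trajProb_pos_iff.1 hω h).2
  rw [DetPolicy.toPolicy, vertex_apply, if_neg hne] at this
  exact lt_irrefl _ this

theorem mem_suppSA_of_mem_suppS {π : DetPolicy S A H} {h : Fin H} {s : S}
    (hs : (s, h) ∈ suppS μ₀ p π.toPolicy) : (s, π h s, h) ∈ suppSA μ₀ p π.toPolicy := by
  obtain ⟨ω, hω, rfl⟩ := mem_suppS_iff.1 hs
  exact mem_suppSA_iff.2 ⟨ω, hω, Prod.ext rfl (action_eq_of_trajProb_pos hω h)⟩

theorem isClosedUnder_suppS [Nonempty S] [Nonempty A] (π : DetPolicy S A H) :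
    IsClosedUnder (suppS μ₀ p π.toPolicy) p π :=
  fun _ _ _ hh hs _ h0 => suppS_next hh (mem_suppSA_of_mem_suppS hs) h0

/-- Coverage: the expert's actions on the expert's support are visited by `πb`. -/
theorem mem_suppSA_of_covers {πE : DetPolicy S A H} {πb : Policy S A H}
    (hcov : ∀ s h, (s, h) ∈ suppS μ₀ p πE.toPolicy → 0 < πb h s (πE h s)) {s : S} {h : Fin H}
    (hs : (s, h) ∈ suppS μ₀ p πE.toPolicy) : (s, πE h s, h) ∈ suppSA μ₀ p πb := by
  obtain ⟨ω, hω, rfl⟩ := mem_suppS_iff.1 hs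
  -- The same trajectory is possible under `πb`: the state factors are unchanged, and every action
  -- on it is an expert's action at a supported state.
  refine mem_suppSA_iff.2 ⟨ω, trajProb_pos_iff.2 fun k => ⟨(trajProb_pos_iff.1 hω k).1, ?_⟩,
    Prod.ext rfl (action_eq_of_trajProb_pos hω h)⟩
  rw [action_eq_of_trajProb_pos hω k]
  exact hcov _ _ (mem_suppS_iff.2 ⟨ω, hω, rfl⟩)

/-! ### Feasible sets -/

/-- Maximal utility only says that the value is optimal at the initial states of positive mass. This
propagates along possible expert trajectories, which reach the whole support; the converse follows
from closedness. -/
theorem feasible_eq_greedyOn [Nonempty S] [Nonempty A] (hH : 0 < H) {p' : Transition S A H}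
    {πE : DetPolicy S A H}
    (hp : ∀ s h, (s, h) ∈ suppS μ₀ p πE.toPolicy → p' h s (πE h s) = p h s (πE h s)) :
    feasible μ₀ p' πE = greedyOn (suppS μ₀ p πE.toPolicy) (expect p') πE := by
  have hcl : IsClosedUnder (suppS μ₀ p πE.toPolicy) p' πE := by
    intro s h h' hh hs s' h0
    rw [hp s h hs] at h0
    exact isClosedUnder_suppS πE s h h' hh hs s' h0
  refine Set.Subset.antisymm (fun r hr => ?_) fun r hr π' => ?_
  · choose g hg using exists_greedy (expect p') r
    have hgv : ∀ h, value p' (DetPolicy.toPolicy g) r h = optVal (expect p') r h := by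
      have hc : IsClosedUnder Set.univ p' g := fun _ _ _ _ _ _ _ => Set.mem_univ _
      intro h
      funext s
      by_cases hh : h < H
      · exact value_eq_optVal_of_greedyOn hc (fun s h _ => hg h s)
          (π' := DetPolicy.toPolicy g) (fun _ _ _ => rfl) h hh s (Set.mem_univ _)
      · rw [optVal_of_le _ _ (by omega), value_of_le _ _ _ (by omega)]
    have hle := value_le_optVal p' πE.toPolicy r
    -- Compared with the greedy policy, the `μ₀`-average of the nonnegative gaps cannot be positive,
    -- so each gap of positive weight is zero.
    have heq : ∀ s, 0 < μ₀ s → value p' πE.toPolicy r 0 s = optVal (expect p') r 0 s := by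
      have h1 := hr (DetPolicy.toPolicy g)
      rw [utility, utility, hgv] at h1
      have h2 : ∀ s ∈ Finset.univ, μ₀ s * value p' πE.toPolicy r 0 s ≤
          μ₀ s * optVal (expect p') r 0 s := fun s _ =>
        mul_le_mul_of_nonneg_left (hle 0 s) (stdSimplex.zero_le _ _)
      have h3 := (Finset.sum_eq_sum_iff_of_le h2).1 (le_antisymm (Finset.sum_le_sum h2) h1)
      intro s hs
      exact mul_left_cancel₀ hs.ne' (h3 s (Finset.mem_univ s))
    -- Optimality at one state forces equality in value ≤ Q of the expert's action ≤ optimal value,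
    -- and then at every successor of positive probability.
    have hstep : ∀ (h : Fin H) s, value p' πE.toPolicy r h s = optVal (expect p') r h s →
        (∀ a, optQ (expect p') r h s a ≤ optQ (expect p') r h s (πE h s)) ∧
        ∀ s', 0 < p' h s (πE h s) s' →
          value p' πE.toPolicy r (h.val + 1) s' = optVal (expect p') r (h.val + 1) s' := by
      intro h s hs
      rw [value_of_eq_vertex (a := πE h s) rfl, qValue_eq] at hs
      have h1 : optQ (expect p') r h s (πE h s) = optVal (expect p') r h s := by
        refine le_antisymm (optQ_le_optVal _ _ _ _ _) ?_
        rw [← hs]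
        exact add_le_add le_rfl (expect_mono p' _ _ _ (hle _))
      refine ⟨fun a => h1 ▸ optQ_le_optVal _ _ _ _ _, ?_⟩
      have h2 : expect p' h s (πE h s) (value p' πE.toPolicy r (h.val + 1)) =
          expect p' h s (πE h s) (optVal (expect p') r (h.val + 1)) := by
        rw [← h1, optQ] at hs
        exact add_left_cancel hs
      have h3 := (Finset.sum_eq_sum_iff_of_le (fun s' _ =>
        mul_le_mul_of_nonneg_left (hle (h.val + 1) s') (stdSimplex.zero_le _ s'))).1 h2
      intro s' hs'
      exact mul_left_cancel₀ hs'.ne' (h3 s' (Finset.mem_univ s'))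
    intro s h hs
    obtain ⟨ω, hω, rfl⟩ := mem_suppS_iff.1 hs
    refine (hstep h _ ?_).1
    obtain ⟨h, hh⟩ := h
    clear hs
    induction h with
    | zero =>
      refine heq _ ?_
      have := (trajProb_pos_iff.1 hω ⟨0, hh⟩).1
      simpa [stateLaw] using this
    | succ h ih =>
      have hh' : h < H := by omega
      refine (hstep ⟨h, hh'⟩ _ (ih hh')).2 _ ?_
      rw [hp _ _ (mem_suppS_iff.2 ⟨ω, hω, rfl⟩)]
      have := trajProb_pos_next hω ⟨h, hh'⟩ hh
      rwa [action_eq_of_trajProb_pos hω] at this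
  · refine Finset.sum_le_sum fun s _ => ?_
    rcases (stdSimplex.zero_le μ₀ s).eq_or_lt with h0 | h0
    · rw [← h0, zero_mul, zero_mul]
    · refine mul_le_mul_of_nonneg_left ?_ h0.le
      rw [value_eq_optVal_of_greedyOn hcl hr (π' := πE.toPolicy) (fun _ _ _ => rfl) 0 hH s
        (suppS_zero rfl h0)]
      exact value_le_optVal p' π' r 0 s

theorem feasible_eq_feasibleOn [Nonempty S] [Nonempty A] (hH : 0 < H) {p' : Transition S A H}
    {πE : DetPolicy S A H} {πb : Policy S A H}
    (hcov : ∀ s h, (s, h) ∈ suppS μ₀ p πE.toPolicy → 0 < πb h s (πE h s))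
    (hp : p' ∈ transitionClass (suppSA μ₀ p πb) p) :
    feasible μ₀ p' πE = feasibleOn (suppS μ₀ p πE.toPolicy) p' πE := by
  rw [feasible_eq_greedyOn (p := p) hH fun s h hs => hp _ _ _ (mem_suppSA_of_covers hcov hs),
    feasibleOn_eq_greedyOn ((isClosedUnder_suppS πE).of_mem_transitionClass
      (fun s h hs => mem_suppSA_of_covers hcov hs) hp)]

end Trajectories

/-! ### Exponential moments -/

section Moments

/-- Independence of the trajectories: the expectation of a product factorizes. -/
theorem sum_prod_weight_mul_prod {Ω : Type*} [Fintype Ω] (w g : Ω → ℝ) (τ : ℕ) :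
    ∑ D : Fin τ → Ω, (∏ i, w (D i)) * ∏ i, g (D i) = (∑ ω, w ω * g ω) ^ τ := by
  classical
  rw [Fintype.sum_pow]
  simp only [Finset.prod_mul_distrib]

/-- The right side is the chord of the convex function over `[-2, 2]`; being affine in `y`, it
reduces to `cosh (2 * l)` on averaging a centered variable. -/
theorem exp_mul_le_cosh_add {l y : ℝ} (hy : |y| ≤ 2) :
    Real.exp (l * y) ≤ Real.cosh (2 * l) + y / 2 * Real.sinh (2 * l) := by
  obtain ⟨h1, h2⟩ := abs_le.1 hy
  have h := convexOn_exp.2 (Set.mem_univ (2 * l)) (Set.mem_univ (-(2 * l)))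
    (show 0 ≤ (2 + y) / 4 by linarith) (show 0 ≤ (2 - y) / 4 by linarith) (by ring)
  simp only [smul_eq_mul] at h
  rw [Real.cosh_eq, Real.sinh_eq]
  calc Real.exp (l * y) = Real.exp ((2 + y) / 4 * (2 * l) + (2 - y) / 4 * -(2 * l)) := by
        congr 1; ring
    _ ≤ _ := h
    _ = _ := by ring

/-- Hoeffding's lemma for functions with values in `[-1, 1]`, with a suboptimal constant. -/
theorem sum_mul_exp_centered_le {S : Type*} [Fintype S] (q : stdSimplex ℝ S) {f : S → ℝ}
    (hf : ∀ s, |f s| ≤ 1) (l : ℝ) :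
    ∑ s, q s * Real.exp (l * (f s - ∑ x, q x * f x)) ≤ Real.exp (2 * l ^ 2) := by
  set m := ∑ x, q x * f x with hm
  have hm1 : |m| ≤ 1 := by
    refine (Finset.abs_sum_le_sum_abs _ _).trans ?_
    rw [← stdSimplex.sum_eq_one q]
    refine Finset.sum_le_sum fun s _ => ?_
    rw [abs_mul, abs_of_nonneg (stdSimplex.zero_le q s)]
    exact mul_le_of_le_one_right (stdSimplex.zero_le q s) (hf s)
  calc ∑ s, q s * Real.exp (l * (f s - m))
      ≤ ∑ s, q s * (Real.cosh (2 * l) + (f s - m) / 2 * Real.sinh (2 * l)) := by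
        refine Finset.sum_le_sum fun s _ =>
          mul_le_mul_of_nonneg_left (exp_mul_le_cosh_add ?_) (stdSimplex.zero_le q s)
        exact (abs_sub _ _).trans (by linarith [hf s])
    _ = ∑ s, (q s * (Real.cosh (2 * l) - m / 2 * Real.sinh (2 * l)) +
          q s * f s * (Real.sinh (2 * l) / 2)) := Finset.sum_congr rfl fun s _ => by ring
    _ = Real.cosh (2 * l) := by
        rw [Finset.sum_add_distrib, ← Finset.sum_mul, ← Finset.sum_mul, stdSimplex.sum_eq_one,
          ← hm]
        ring
    _ ≤ Real.exp ((2 * l) ^ 2 / 2) := Real.cosh_le_exp_half_sq _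
    _ = Real.exp (2 * l ^ 2) := by congr 1; ring

/-- The sign function of a partition of `U` into `V` and `U \ V`. -/
def signFun {S : Type*} [DecidableEq S] (U V : Finset S) (s : S) : ℝ :=
  (if s ∈ V then 1 else 0) - if s ∈ U \ V then 1 else 0

theorem abs_signFun_le {S : Type*} [DecidableEq S] (U V : Finset S) (s : S) :
    |signFun U V s| ≤ 1 := by
  unfold signFun
  by_cases hV : s ∈ V <;> by_cases hU : s ∈ U <;> simp [hV, hU]

/-- Expand the product of the bounds e^|y| ≤ e^y + e^(-y): each subset selects a sign pattern. This
replaces a union bound over the duals of the ℓ¹-norm. -/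
theorem exp_sum_abs_le {S : Type*} [Fintype S] [DecidableEq S] (U : Finset S) (x : S → ℝ) :
    Real.exp (∑ s ∈ U, |x s|) ≤
      ∑ V ∈ U.powerset, Real.exp (∑ s, signFun U V s * x s) := by
  have hexp : ∀ y : ℝ, Real.exp |y| ≤ Real.exp y + Real.exp (-y) := by
    intro y
    rcases abs_choice y with h | h <;> rw [h]
    · linarith [Real.exp_pos (-y)]
    · linarith [Real.exp_pos y]
  rw [Real.exp_sum]
  refine (Finset.prod_le_prod (fun _ _ => (Real.exp_pos _).le) fun s _ => hexp (x s)).trans ?_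
  rw [Finset.prod_add]
  refine Finset.sum_le_sum fun V _ => le_of_eq ?_
  rw [← Real.exp_sum, ← Real.exp_sum, ← Real.exp_add]
  congr 1
  simp only [signFun, sub_mul, ite_mul, one_mul, zero_mul, Finset.sum_sub_distrib,
    Finset.sum_ite_mem, Finset.univ_inter, Finset.sum_neg_distrib]
  ring

end Moments

/-! ### Concentration of visit counts and empirical transitions -/

section Concentration

variable {S A : Type*} [Fintype S] [Fintype A] [DecidableEq S] [DecidableEq A] {H : ℕ}
  (μ₀ : stdSimplex ℝ S) (p : Transition S A H) (π : Policy S A H) {τ : ℕ}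

/-- The probability of a dataset. -/
def dataWeight (D : Dataset S A H τ) : ℝ := ∏ i, trajProb μ₀ p π (D i)

theorem dataWeight_nonneg (D : Dataset S A H τ) : 0 ≤ dataWeight μ₀ p π D :=
  Finset.prod_nonneg fun i _ => trajProb_nonneg μ₀ p π (D i)

theorem sum_dataWeight [Nonempty S] [Nonempty A] :
    ∑ D : Dataset S A H τ, dataWeight μ₀ p π D = 1 := by
  have := sum_prod_weight_mul_prod (trajProb μ₀ p π) (fun _ => 1) τ
  simpa [dataWeight, sum_trajProb] using this

theorem sum_dataWeight_mul_exp_sum (g : Traj S A H → ℝ) :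
    ∑ D : Dataset S A H τ, dataWeight μ₀ p π D * Real.exp (∑ i, g (D i)) =
      (∑ ω, trajProb μ₀ p π ω * Real.exp (g ω)) ^ τ := by
  rw [← sum_prod_weight_mul_prod]
  simp only [dataWeight, Real.exp_sum]

theorem visitSA_mul_one_add [Nonempty S] [Nonempty A] (h : Fin H) (s : S) (a : A) (c : ℝ) :
    ∑ ω, trajProb μ₀ p π ω * (if ω h = (s, a) then c else 1) =
      1 + visitSA μ₀ p π h s a * (c - 1) := by
  have h1 : 1 + visitSA μ₀ p π h s a * (c - 1) =
      ∑ ω, trajProb μ₀ p π ω + visitSA μ₀ p π h s a * (c - 1) := by rw [sum_trajProb]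
  rw [h1, visitSA, Finset.sum_mul, ← Finset.sum_add_distrib]
  refine Finset.sum_congr rfl fun ω _ => ?_
  split_ifs <;> ring

/-- The probability that `(s, a, h)` does not occur, as the indicator of this event. -/
def unseen (h : Fin H) (s : S) (a : A) (D : Dataset S A H τ) : ℝ :=
  ∏ i, if D i h = (s, a) then 0 else 1

theorem unseen_nonneg (h : Fin H) (s : S) (a : A) (D : Dataset S A H τ) : 0 ≤ unseen h s a D :=
  Finset.prod_nonneg fun i _ => by split_ifs <;> norm_num

theorem exists_of_unseen_lt_one {h : Fin H} {s : S} {a : A} {D : Dataset S A H τ}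
    (hD : unseen h s a D < 1) : ∃ i, D i h = (s, a) := by
  by_contra! hne
  simp [unseen, hne] at hD

theorem sum_dataWeight_mul_unseen [Nonempty S] [Nonempty A] (h : Fin H) (s : S) (a : A) :
    ∑ D : Dataset S A H τ, dataWeight μ₀ p π D * unseen h s a D =
      (1 - visitSA μ₀ p π h s a) ^ τ := by
  simp only [unseen, dataWeight]
  rw [sum_prod_weight_mul_prod (trajProb μ₀ p π) (fun ω => if ω h = (s, a) then 0 else 1),
    visitSA_mul_one_add]
  ring

theorem visitSA_le_one [Nonempty S] [Nonempty A] (h : Fin H) (s : S) (a : A) :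
    visitSA μ₀ p π h s a ≤ 1 := by
  rw [← sum_trajProb μ₀ p π, visitSA]
  refine Finset.sum_le_sum fun ω _ => ?_
  split_ifs
  · exact le_rfl
  · exact trajProb_nonneg μ₀ p π ω

/-- The number of visits of `(s, a, h)`. -/
def visits (h : Fin H) (s : S) (a : A) (D : Dataset S A H τ) : ℝ :=
  ∑ i, if D i h = (s, a) then 1 else 0

/-- Lower tail of the number of visits. -/
theorem sum_dataWeight_mul_exp_neg_visits_le [Nonempty S] [Nonempty A] (h : Fin H) (s : S)
    (a : A) :
    ∑ D : Dataset S A H τ, dataWeight μ₀ p π D *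
      Real.exp (τ * visitSA μ₀ p π h s a / 2 - visits h s a D) ≤ 1 := by
  set ρ := visitSA μ₀ p π h s a with hρ
  -- This makes the moment of one trajectory at most e^(ρ/2)(1 - ρ/2) ≤ 1.
  have he : Real.exp (-1) ≤ 1 / 2 := by
    rw [Real.exp_neg, one_div]
    exact inv_anti₀ (by norm_num) (by linarith [Real.add_one_le_exp (1 : ℝ)])
  have hρ0 : 0 ≤ ρ := visitSA_nonneg μ₀ p π h s a
  have hρ1 : ρ ≤ 1 := visitSA_le_one μ₀ p π h s a
  have h1 : ∀ D : Dataset S A H τ, Real.exp (τ * ρ / 2 - visits h s a D) =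
      Real.exp (∑ i, (ρ / 2 + if D i h = (s, a) then -1 else 0)) := by
    intro D
    congr 1
    rw [Finset.sum_add_distrib, visits, sub_eq_add_neg, ← Finset.sum_neg_distrib]
    congr 1
    · simp; ring
    · exact Finset.sum_congr rfl fun i _ => by split_ifs <;> simp
  simp only [h1]
  rw [sum_dataWeight_mul_exp_sum μ₀ p π fun ω => ρ / 2 + if ω h = (s, a) then -1 else 0]
  refine pow_le_one₀ ?_ ?_
  · exact Finset.sum_nonneg fun ω _ => mul_nonneg (trajProb_nonneg μ₀ p π ω) (Real.exp_pos _).le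
  · have h2 : ∀ ω : Traj S A H, Real.exp (ρ / 2 + if ω h = (s, a) then -1 else 0) =
        Real.exp (ρ / 2) * if ω h = (s, a) then Real.exp (-1) else 1 := by
      intro ω
      rw [Real.exp_add]
      split_ifs <;> simp
    simp only [h2, mul_left_comm _ (Real.exp (ρ / 2)), ← Finset.mul_sum]
    rw [visitSA_mul_one_add, ← hρ]
    calc Real.exp (ρ / 2) * (1 + ρ * (Real.exp (-1) - 1))
        ≤ Real.exp (ρ / 2) * Real.exp (-(ρ / 2)) := by
          refine mul_le_mul_of_nonneg_left ?_ (Real.exp_pos _).le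
          refine le_trans ?_ (Real.add_one_le_exp _)
          nlinarith
      _ = 1 := by rw [← Real.exp_add, add_neg_cancel, Real.exp_zero]

variable {h : Fin H} (hh : h.val + 1 < H) (s : S) (a : A)

/-- The deviation from `p` of the transition to `s'` from `(s, a)` at stage `h` of `ω`. -/
def deviation (ω : Traj S A H) (s' : S) : ℝ :=
  if ω h = (s, a) then (if (ω ⟨h.val + 1, hh⟩).1 = s' then 1 else 0) - p h s a s' else 0

theorem sum_mul_deviation (ω : Traj S A H) (f : S → ℝ) :
    ∑ s', f s' * deviation p hh s a ω s' =
      if ω h = (s, a) then f (ω ⟨h.val + 1, hh⟩).1 - ∑ x, p h s a x * f x else 0 := by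
  unfold deviation
  split_ifs
  · simp only [mul_sub, Finset.sum_sub_distrib, mul_ite, mul_one, mul_zero, Finset.sum_ite_eq,
      Finset.mem_univ, if_true]
    congr 1
    exact Finset.sum_congr rfl fun _ _ => mul_comm _ _
  · simp

/-- Without a visit the exponent vanishes; given a visit, the Markov property and Hoeffding's lemma
apply. The compensator is charged per visit, so the random number of visits never has to be
conditioned on. -/
theorem sum_trajProb_mul_exp_deviation_le [Nonempty S] [Nonempty A] {f : S → ℝ}
    (hf : ∀ s, |f s| ≤ 1) (l : ℝ) :
    ∑ ω, trajProb μ₀ p π ω * Real.exp (l * ∑ s', f s' * deviation p hh s a ω s' -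
      2 * l ^ 2 * if ω h = (s, a) then 1 else 0) ≤ 1 := by
  set m := ∑ x, p h s a x * f x with hm
  set g : S → ℝ := fun x => Real.exp (l * (f x - m)) * Real.exp (-(2 * l ^ 2)) with hg
  have h1 : ∀ ω : Traj S A H, trajProb μ₀ p π ω *
      Real.exp (l * ∑ s', f s' * deviation p hh s a ω s' -
        2 * l ^ 2 * if ω h = (s, a) then 1 else 0) =
      trajProb μ₀ p π ω * (if ω h = (s, a) then 0 else 1) +
        trajProb μ₀ p π ω * (if ω h = (s, a) then g (ω ⟨h.val + 1, hh⟩).1 else 0) := by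
    intro ω
    rw [sum_mul_deviation, ← mul_add, ← hm]
    split_ifs
    · simp only [hg, ← Real.exp_add]
      congr 1
      rw [zero_add]
      congr 1
      ring
    · simp
  rw [Finset.sum_congr rfl fun ω _ => h1 ω, Finset.sum_add_distrib, visitSA_mul_one_add,
    sum_trajProb_next]
  have h2 : ∑ x, p h s a x * g x ≤ 1 := by
    simp only [hg, ← mul_assoc, ← Finset.sum_mul]
    calc _ ≤ Real.exp (2 * l ^ 2) * Real.exp (-(2 * l ^ 2)) :=
          mul_le_mul_of_nonneg_right (sum_mul_exp_centered_le _ hf l) (Real.exp_pos _).le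
      _ = 1 := by rw [← Real.exp_add, add_neg_cancel, Real.exp_zero]
  nlinarith [visitSA_nonneg μ₀ p π h s a]

/-- The exponential moment of the `ℓ¹`-deviation of the empirical transitions on `U`. -/
theorem sum_dataWeight_mul_exp_deviation_le [Nonempty S] [Nonempty A] (U : Finset S) {l : ℝ}
    (hl : 0 ≤ l) :
    ∑ D : Dataset S A H τ, dataWeight μ₀ p π D *
      Real.exp (l * ∑ s' ∈ U, |∑ i, deviation p hh s a (D i) s'| - 2 * l ^ 2 * visits h s a D) ≤
      2 ^ U.card := by
  have h1 : ∀ D : Dataset S A H τ, dataWeight μ₀ p π D *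
      Real.exp (l * ∑ s' ∈ U, |∑ i, deviation p hh s a (D i) s'| - 2 * l ^ 2 * visits h s a D) ≤
      ∑ V ∈ U.powerset, dataWeight μ₀ p π D * Real.exp (∑ i,
        (l * ∑ s', signFun U V s' * deviation p hh s a (D i) s' -
          2 * l ^ 2 * if D i h = (s, a) then 1 else 0)) := by
    intro D
    rw [← Finset.mul_sum]
    refine mul_le_mul_of_nonneg_left ?_ (dataWeight_nonneg μ₀ p π D)
    have h2 := exp_sum_abs_le U fun s' => l * ∑ i, deviation p hh s a (D i) s'
    simp only [abs_mul, abs_of_nonneg hl, ← Finset.mul_sum] at h2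
    rw [Real.exp_sub]
    refine (div_le_div_of_nonneg_right h2 (Real.exp_pos _).le).trans (le_of_eq ?_)
    rw [Finset.sum_div]
    refine Finset.sum_congr rfl fun V _ => ?_
    rw [← Real.exp_sub, Finset.sum_sub_distrib, ← Finset.mul_sum, ← Finset.mul_sum, visits,
      Finset.sum_comm (s := (Finset.univ : Finset (Fin τ)))]
    congr 2
    rw [Finset.mul_sum]
    refine Finset.sum_congr rfl fun s' _ => ?_
    rw [← Finset.mul_sum]
    ring
  refine (Finset.sum_le_sum fun D _ => h1 D).trans ?_
  rw [Finset.sum_comm]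
  calc _ ≤ ∑ V ∈ U.powerset, (1 : ℝ) := by
        refine Finset.sum_le_sum fun V _ => ?_
        rw [sum_dataWeight_mul_exp_sum μ₀ p π fun ω =>
          l * ∑ s', signFun U V s' * deviation p hh s a ω s' -
            2 * l ^ 2 * if ω h = (s, a) then 1 else 0]
        refine pow_le_one₀ ?_ (sum_trajProb_mul_exp_deviation_le μ₀ p π hh s a
          (abs_signFun_le U V) l)
        exact Finset.sum_nonneg fun ω _ =>
          mul_nonneg (trajProb_nonneg μ₀ p π ω) (Real.exp_pos _).le
    _ = 2 ^ U.card := by simp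

/-! ### Empirical transitions -/

variable {s a}

theorem sum_count (D : Dataset S A H τ) :
    ((∑ x, count D h hh s a x : ℕ) : ℝ) = visits h s a D := by
  simp only [count, visits, Finset.card_filter]
  rw [Finset.sum_comm]
  push_cast
  refine Finset.sum_congr rfl fun i _ => ?_
  by_cases hi : D i h = (s, a) <;> simp [hi]

theorem sum_deviation (D : Dataset S A H τ) (s' : S) :
    ∑ i, deviation p hh s a (D i) s' = count D h hh s a s' - p h s a s' * visits h s a D := by
  simp only [count, visits, deviation, Finset.card_filter]
  push_cast
  rw [Finset.mul_sum, ← Finset.sum_sub_distrib]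
  refine Finset.sum_congr rfl fun i _ => ?_
  by_cases hi : D i h = (s, a) <;> simp [hi]

theorem one_le_visits {D : Dataset S A H τ} (hD : ∃ i, D i h = (s, a)) :
    1 ≤ visits h s a D := by
  obtain ⟨i, hi⟩ := hD
  have := Finset.single_le_sum (f := fun i => if D i h = (s, a) then (1 : ℝ) else 0)
    (fun j _ => by split_ifs <;> norm_num) (Finset.mem_univ i)
  simpa [hi, visits] using this

theorem empTransition_eq {D : Dataset S A H τ} (hD : ∃ i, D i h = (s, a)) (s' : S) :
    empTransition D h hh s a s' = count D h hh s a s' / visits h s a D := by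
  have h1 := one_le_visits hD
  rw [← sum_count hh] at h1 ⊢
  rw [empTransition, max_eq_right (by exact_mod_cast h1)]

theorem sum_empTransition {D : Dataset S A H τ} (hD : ∃ i, D i h = (s, a)) :
    ∑ s', empTransition D h hh s a s' = 1 := by
  have h1 := one_le_visits hD
  simp only [empTransition_eq hh hD]
  rw [← Finset.sum_div, ← Nat.cast_sum, sum_count, div_self (by linarith)]

theorem empTransition_nonneg (D : Dataset S A H τ) (s' : S) :
    0 ≤ empTransition D h hh s a s' := by
  unfold empTransition
  positivity

/-- A counted transition lies on a possible trajectory. Hence estimation creates no new successors,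
and the expert's support remains closed in the empirical model. -/
theorem transition_pos_of_empTransition_pos {μ₀ : stdSimplex ℝ S} {p : Transition S A H}
    {π : Policy S A H} {D : Dataset S A H τ} (hD : ∀ i, 0 < trajProb μ₀ p π (D i)) {s' : S}
    (h0 : 0 < empTransition D h hh s a s') : 0 < p h s a s' := by
  have hc : count D h hh s a s' ≠ 0 := by
    intro hc
    simp [empTransition, hc] at h0
  obtain ⟨i, hi⟩ := Finset.card_ne_zero.1 hc
  obtain ⟨-, h1, h2⟩ := Finset.mem_filter.1 hi
  have := trajProb_pos_next (hD i) h hh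
  rwa [h1, h2] at this

end Concentration

/-! ### Real inequalities -/

section RealInequalities

theorem one_sub_pow_le_exp_neg {ρ m L C : ℝ} {τ : ℕ} (hm : 0 < m) (hmρ : m ≤ ρ) (hρ : ρ ≤ 1)
    (hL : 0 ≤ L) (hC : 1 ≤ C) (hτ1 : 1 ≤ τ) (hτ : C * (L / Real.log (1 / (1 - m))) ≤ τ) :
    (1 - ρ) ^ τ ≤ Real.exp (-L) := by
  -- If `m = 1`, the quotient in `hτ` is `0` by convention and carries no information; then `ρ = 1`,
  -- and one trajectory suffices.
  rcases (hmρ.trans hρ).eq_or_lt with h1 | h1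
  · have : ρ = 1 := le_antisymm hρ (h1 ▸ hmρ)
    rw [this, sub_self, zero_pow (by omega)]
    exact (Real.exp_pos _).le
  · have h0 : 0 < 1 - m := by linarith
    set l := Real.log (1 / (1 - m)) with hl
    have hexp : Real.exp (-l) = 1 - m := by
      rw [hl, one_div, Real.log_inv, neg_neg, Real.exp_log h0]
    have hl0 : 0 < l := by
      rw [hl]
      refine Real.log_pos ?_
      rw [lt_div_iff₀ h0]
      linarith
    have hLl : L / l ≤ τ := (le_mul_of_one_le_left (div_nonneg hL hl0.le) hC).trans hτ
    rw [div_le_iff₀ hl0] at hLl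
    calc (1 - ρ) ^ τ ≤ (1 - m) ^ τ := pow_le_pow_left₀ (by linarith) (by linarith) τ
      _ = Real.exp (-(τ * l)) := by rw [← hexp, ← Real.exp_nat_mul]; congr 1; ring
      _ ≤ Real.exp (-L) := Real.exp_le_exp.2 (by linarith)

/-- The deviation bound that results from the two exponential tail bounds. -/
theorem mul_deviation_le_sqrt {τ t ρ N Δ : ℝ} (hτ : 0 < τ) (ht : 0 < t) (hρ : 0 < ρ)
    (hΔ : Δ ≤ 2) (hN : τ * ρ / 2 - N < t)
    (hdev : √(t / (τ * ρ)) * (N * Δ) - 2 * √(t / (τ * ρ)) ^ 2 * N < t) :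
    ρ * Δ ≤ 6 * √(ρ * t / τ) := by
  set l := √(t / (τ * ρ)) with hl
  have hx : 0 < τ * ρ := mul_pos hτ hρ
  have hl0 : 0 < l := Real.sqrt_pos.2 (div_pos ht hx)
  have hl2 : l ^ 2 * (τ * ρ) = t := by
    rw [hl, Real.sq_sqrt (div_pos ht hx).le]
    field_simp
  have hsq : √(ρ * t / τ) = ρ * l := by
    rw [← Real.sqrt_sq (mul_pos hρ hl0).le, mul_pow]
    congr 1
    rw [← hl2]
    field_simp
  rw [hsq]
  -- If τρ ≥ 4t, then N ≥ τρ/4, so t ≤ 4l²N and lNΔ < 2l²N + t ≤ 6l²N. Otherwise l > 1/2, and the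
  -- trivial bound Δ ≤ 2 is enough.
  rcases le_or_gt (4 * t) (τ * ρ) with hc | hc
  · have hN4 : τ * ρ / 4 ≤ N := by linarith
    have hNpos : 0 < N := by linarith
    have h1 : t ≤ 4 * l ^ 2 * N := by nlinarith [sq_nonneg l]
    have h2 : l * N * Δ < l * N * (6 * l) := by nlinarith
    have h3 : Δ < 6 * l := lt_of_mul_lt_mul_left h2 (mul_pos hl0 hNpos).le
    nlinarith
  · have h1 : 1 / 4 < l ^ 2 := by
      by_contra! h
      nlinarith
    have h2 : 1 / 2 < l := by
      by_contra! h
      nlinarith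
    nlinarith

end RealInequalities

/-! ### From distances of models to distances of reward sets -/

section Distances

variable {S A : Type*} [Fintype S] [Fintype A] [DecidableEq S] [DecidableEq A] {H : ℕ}
  {μ₀ : stdSimplex ℝ S} {p q : Transition S A H}

theorem hausdorff_le {c : Reward S A H → Reward S A H → ℝ} {R R' : Set (Reward S A H)} {ε : ℝ}
    (h1 : ∀ r ∈ R, ∃ r' ∈ R', c r r' ≤ ε) (h2 : ∀ r' ∈ R', ∃ r ∈ R, c r r' ≤ ε) :
    hausdorff c R R' ≤ ENNReal.ofReal ε := by
  refine max_le (iSup₂_le fun r hr => ?_) (iSup₂_le fun r' hr' => ?_)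
  · obtain ⟨r', hr', hc⟩ := h1 r hr
    exact (iInf₂_le r' hr').trans (ENNReal.ofReal_le_ofReal hc)
  · obtain ⟨r, hr, hc⟩ := h2 r' hr'
    exact (iInf₂_le r hr).trans (ENNReal.ofReal_le_ofReal hc)

/-- The average `ℓ¹`-distance between the rows of two transition models, summed over stages. -/
def modelDist (μ₀ : stdSimplex ℝ S) (p : Transition S A H) (π : Policy S A H)
    (q : Transition S A H) : ℝ :=
  ∑ h, ∑ s, ∑ a, visitSA μ₀ p π h s a * ∑ s', |p h s a s' - q h s a s'|

theorem rewardDist_le_of_isClose {π : Policy S A H} {r r' : Reward S A H} {M : ℝ}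
    (hM : M ≤ max ‖r‖ ‖r'‖) (hc : IsClose (suppSA μ₀ p π) p q M r r') :
    rewardDist μ₀ p π r r' ≤ H * modelDist μ₀ p π q := by
  have hnn : 0 ≤ modelDist μ₀ p π q :=
    Finset.sum_nonneg fun h _ => Finset.sum_nonneg fun s _ => Finset.sum_nonneg fun a _ =>
      mul_nonneg (visitSA_nonneg μ₀ p π h s a) (Finset.sum_nonneg fun _ _ => abs_nonneg _)
  set K := max ‖r‖ ‖r'‖ with hK
  have hK0 : 0 ≤ K := (norm_nonneg r).trans (le_max_left _ _)
  rcases hK0.eq_or_lt with h0 | h0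
  -- Both rewards vanish, and division by zero gives the prescribed value `0`.
  · rw [rewardDist, ← hK, ← h0, div_zero]
    positivity
  rw [rewardDist, ← hK, div_le_iff₀ h0, modelDist, Finset.mul_sum, Finset.sum_mul]
  refine Finset.sum_le_sum fun h _ => ?_
  have hsup : (⨆ x : {x : S × A // (x.1, x.2, h) ∉ suppSA μ₀ p π},
      |r h x.1.1 x.1.2 - r' h x.1.1 x.1.2|) = 0 := by
    have : ∀ x : {x : S × A // (x.1, x.2, h) ∉ suppSA μ₀ p π},
        |r h x.1.1 x.1.2 - r' h x.1.1 x.1.2| = 0 := fun x => by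
      rw [hc.2 _ _ _ x.2, sub_self, abs_zero]
    simp only [this, Real.iSup_const_zero]
  rw [hsup, add_zero, Finset.mul_sum, Finset.sum_mul]
  refine Finset.sum_le_sum fun s _ => ?_
  rw [Finset.mul_sum, Finset.sum_mul]
  refine Finset.sum_le_sum fun a _ => ?_
  rcases (visitSA_nonneg μ₀ p π h s a).eq_or_lt with hz | hz
  · rw [← hz]
    simp
  · have h1 := hc.1 s a h hz
    set T := ∑ s', |p h s a s' - q h s a s'|
    have hT : 0 ≤ T := Finset.sum_nonneg fun _ _ => abs_nonneg _
    calc visitSA μ₀ p π h s a * |r h s a - r' h s a|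
        ≤ visitSA μ₀ p π h s a * (H * K * T) := by
          refine mul_le_mul_of_nonneg_left (h1.trans ?_) hz.le
          gcongr
      _ = H * (visitSA μ₀ p π h s a * T) * K := by ring

theorem IsClose.symm {Z : Set (S × A × Fin H)} {M : ℝ} {r r' : Reward S A H}
    (hc : IsClose Z q p M r r') : IsClose Z p q M r' r := by
  refine ⟨fun s a h hz => ?_, fun s a h hz => (hc.2 s a h hz).symm⟩
  have := hc.1 s a h hz
  simpa only [abs_sub_comm (r h s a), abs_sub_comm (q h s a _)] using this

end Distances

/-! ### Deterministic analysis of IRLO on good data -/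

section GoodData

variable {S A : Type*} [Fintype S] [Fintype A] [DecidableEq S] [DecidableEq A] {H : ℕ}
  {μ₀ : stdSimplex ℝ S} {p : Transition S A H} {πE : DetPolicy S A H} {πb : Policy S A H}
  {τb τE : ℕ} {Db : Dataset S A H τb} {DE : Dataset S A H τE}

open Classical in
/-- The empirical transition model on the behavioral support, completed by `p`. -/
def empModel (μ₀ : stdSimplex ℝ S) (p : Transition S A H) (πb : Policy S A H)
    (Db : Dataset S A H τb)
    (hseen : ∀ s a h, (s, a, h) ∈ suppSA μ₀ p πb → ∃ i, Db i h = (s, a)) : Transition S A H :=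
  fun h s a => if hz : h.val + 1 < H ∧ (s, a, h) ∈ suppSA μ₀ p πb then
    ⟨empTransition Db h hz.1 s a, empTransition_nonneg hz.1 Db,
      sum_empTransition hz.1 (hseen s a h hz.2)⟩
  else p h s a

variable (hseen : ∀ s a h, (s, a, h) ∈ suppSA μ₀ p πb → ∃ i, Db i h = (s, a))

theorem empModel_apply {h : Fin H} (hh : h.val + 1 < H) {s : S} {a : A}
    (hz : (s, a, h) ∈ suppSA μ₀ p πb) (s' : S) :
    empModel μ₀ p πb Db hseen h s a s' = empTransition Db h hh s a s' := by
  rw [empModel, dif_pos ⟨hh, hz⟩]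
  rfl

theorem empModel_of_last {h : Fin H} (hh : ¬ h.val + 1 < H) (s : S) (a : A) :
    empModel μ₀ p πb Db hseen h s a = p h s a := by
  rw [empModel, dif_neg fun hz => hh hz.1]

theorem transition_pos_of_empModel_pos (hD : ∀ i, 0 < trajProb μ₀ p πb (Db i)) {h : Fin H}
    {s : S} {a : A} {s' : S} (h0 : 0 < empModel μ₀ p πb Db hseen h s a s') :
    0 < p h s a s' := by
  by_cases hz : h.val + 1 < H ∧ (s, a, h) ∈ suppSA μ₀ p πb
  · rw [empModel_apply hseen hz.1 hz.2] at h0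
    exact transition_pos_of_empTransition_pos hz.1 hD h0
  · rwa [empModel, dif_neg hz] at h0

theorem empSuppSA_eq (hD : ∀ i, 0 < trajProb μ₀ p πb (Db i))
    (hseen : ∀ s a h, (s, a, h) ∈ suppSA μ₀ p πb → ∃ i, Db i h = (s, a)) :
    empSuppSA Db = suppSA μ₀ p πb := by
  ext ⟨s, a, h⟩
  refine ⟨?_, hseen s a h⟩
  rintro ⟨i, hi⟩
  exact mem_suppSA_iff.2 ⟨Db i, hD i, hi⟩

theorem empSuppS_eq (hD : ∀ i, 0 < trajProb μ₀ p πE.toPolicy (DE i))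
    (hseenE : ∀ s h, (s, h) ∈ suppS μ₀ p πE.toPolicy → ∃ i, (DE i h).1 = s) :
    empSuppS DE = suppS μ₀ p πE.toPolicy := by
  ext ⟨s, h⟩
  refine ⟨?_, hseenE s h⟩
  rintro ⟨i, hi⟩
  exact mem_suppS_iff.2 ⟨DE i, hD i, hi⟩

theorem transitionClass_empModel_subset (hD : ∀ i, 0 < trajProb μ₀ p πb (Db i)) :
    transitionClass (suppSA μ₀ p πb) (empModel μ₀ p πb Db hseen) ⊆ empTransitionClass Db := by
  intro p' hp' s a h hz hh s'
  rw [empSuppSA_eq hD hseen] at hz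
  rw [hp' s a h hz, empModel_apply hseen hh hz]

/-- The data leave the last stage free, whereas `transitionClass` prescribes it. Overwriting that
stage reconciles the two classes and affects no Q-function (`feasibleOn_congr`). -/
theorem exists_mem_transitionClass_empModel (hD : ∀ i, 0 < trajProb μ₀ p πb (Db i))
    {p' : Transition S A H} (hp' : p' ∈ empTransitionClass Db) :
    ∃ p'' ∈ transitionClass (suppSA μ₀ p πb) (empModel μ₀ p πb Db hseen),
      ∀ h : Fin H, h.val + 1 < H → p'' h = p' h := by
  refine ⟨fun h => if h.val + 1 < H then p' h else empModel μ₀ p πb Db hseen h, ?_,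
    fun h hh => if_pos hh⟩
  intro s a h hz
  by_cases hh : h.val + 1 < H
  · simp only [if_pos hh]
    refine stdSimplex.ext (funext fun s' => ?_)
    rw [empModel_apply hseen hh hz]
    refine hp' s a h ?_ hh s'
    rwa [empSuppSA_eq hD hseen]
  · simp only [if_neg hh]

theorem iInter_empTransitionClass (hD : ∀ i, 0 < trajProb μ₀ p πb (Db i)) (X : Set (S × Fin H))
    (π : DetPolicy S A H) :
    ⋂ p' ∈ empTransitionClass Db, feasibleOn X p' π =
      ⋂ p' ∈ transitionClass (suppSA μ₀ p πb) (empModel μ₀ p πb Db hseen), feasibleOn X p' π := by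
  refine Set.Subset.antisymm
    (Set.biInter_subset_biInter_left (transitionClass_empModel_subset hseen hD)) ?_
  refine Set.subset_iInter₂ fun p' hp' => ?_
  obtain ⟨p'', hp'', he⟩ := exists_mem_transitionClass_empModel hseen hD hp'
  rw [← feasibleOn_congr he]
  exact Set.biInter_subset_of_mem hp''

theorem iUnion_empTransitionClass (hD : ∀ i, 0 < trajProb μ₀ p πb (Db i)) (X : Set (S × Fin H))
    (π : DetPolicy S A H) :
    ⋃ p' ∈ empTransitionClass Db, feasibleOn X p' π =
      ⋃ p' ∈ transitionClass (suppSA μ₀ p πb) (empModel μ₀ p πb Db hseen), feasibleOn X p' π := by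
  refine Set.Subset.antisymm ?_
    (Set.biUnion_subset_biUnion_left (transitionClass_empModel_subset hseen hD))
  refine Set.iUnion₂_subset fun p' hp' => ?_
  obtain ⟨p'', hp'', he⟩ := exists_mem_transitionClass_empModel hseen hD hp'
  rw [← feasibleOn_congr he]
  exact Set.subset_biUnion_of_mem (u := fun p' => feasibleOn X p' π) hp''

theorem irlo_hausdorff_le [Nonempty S] [Nonempty A] (hH : 0 < H)
    (hcov : ∀ s h, (s, h) ∈ suppS μ₀ p πE.toPolicy → 0 < πb h s (πE h s))
    (hDb : ∀ i, 0 < trajProb μ₀ p πb (Db i))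
    (hDE : ∀ i, 0 < trajProb μ₀ p πE.toPolicy (DE i))
    (hseenE : ∀ s h, (s, h) ∈ suppS μ₀ p πE.toPolicy → ∃ i, (DE i h).1 = s)
    {est : Dataset S A H τE → DetPolicy S A H} (hest : IsEmpPolicy DE (est DE)) {ε : ℝ}
    (hε : H * modelDist μ₀ p πb (empModel μ₀ p πb Db hseen) ≤ ε) :
    hausdorff (rewardDist μ₀ p πb) (subFeasible μ₀ p πE πb) (irlo est (Db, DE)).1 ≤
        ENNReal.ofReal ε ∧
      hausdorff (rewardDist μ₀ p πb) (superFeasible μ₀ p πE πb) (irlo est (Db, DE)).2 ≤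
        ENNReal.ofReal ε := by
  set X := suppS μ₀ p πE.toPolicy with hX
  set Z := suppSA μ₀ p πb with hZ
  set q := empModel μ₀ p πb Db hseen with hq
  have hXZ : ∀ s h, (s, h) ∈ X → (s, πE h s, h) ∈ Z := fun s h hs => mem_suppSA_of_covers hcov hs
  have hXp : IsClosedUnder X p πE := isClosedUnder_suppS πE
  have hXq : IsClosedUnder X q πE := fun s h h' hh hs s' h0 =>
    hXp s h h' hh hs s' (transition_pos_of_empModel_pos hseen hDb h0)
  have hXE : empSuppS DE = X := empSuppS_eq hDE hseenE
  have hπ : ∀ s h, (s, h) ∈ X → est DE h s = πE h s := by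
    intro s h hs
    obtain ⟨i, hi, he⟩ := hest s h (hXE ▸ hs)
    rw [he, action_eq_of_trajProb_pos (hDE i), hi]
  have hsub : subFeasible μ₀ p πE πb = ⋂ p' ∈ transitionClass Z p, feasibleOn X p' πE :=
    Set.iInter₂_congr fun p' hp' => feasible_eq_feasibleOn hH hcov hp'
  have hsuper : superFeasible μ₀ p πE πb = ⋃ p' ∈ transitionClass Z p, feasibleOn X p' πE :=
    Set.iUnion₂_congr fun p' hp' => feasible_eq_feasibleOn hH hcov hp'
  have hisub : (irlo est (Db, DE)).1 = ⋂ p' ∈ transitionClass Z q, feasibleOn X p' πE := by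
    simp only [irlo, irloSub, hXE, feasibleOn_congr_policy hπ]
    exact iInter_empTransitionClass hseen hDb X πE
  have hisuper : (irlo est (Db, DE)).2 = ⋃ p' ∈ transitionClass Z q, feasibleOn X p' πE := by
    simp only [irlo, irloSuper, hXE, feasibleOn_congr_policy hπ]
    exact iUnion_empTransitionClass hseen hDb X πE
  -- The transfer error is measured by the norm of the reward one starts from; in either direction
  -- the maximum in the denominator dominates it.
  have hfwd : ∀ r r' : Reward S A H, IsClose Z p q ‖r‖ r r' → rewardDist μ₀ p πb r r' ≤ ε :=
    fun r r' hc => (rewardDist_le_of_isClose (le_max_left _ _) hc).trans hε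
  have hbwd : ∀ r r' : Reward S A H, IsClose Z q p ‖r'‖ r' r → rewardDist μ₀ p πb r r' ≤ ε :=
    fun r r' hc => (rewardDist_le_of_isClose (le_max_right _ _) hc.symm).trans hε
  rw [hsub, hsuper, hisub, hisuper]
  refine ⟨hausdorff_le (fun r hr => ?_) fun r' hr' => ?_,
    hausdorff_le (fun r hr => ?_) fun r' hr' => ?_⟩
  · obtain ⟨r', hr', hc⟩ := exists_isClose_iInter hXp hXq hXZ hr
    exact ⟨r', hr', hfwd r r' hc⟩
  · obtain ⟨r, hr, hc⟩ := exists_isClose_iInter hXq hXp hXZ hr'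
    exact ⟨r, hr, hbwd r r' hc⟩
  · obtain ⟨r', hr', hc⟩ := exists_isClose_iUnion hXp hXq hXZ hr
    exact ⟨r', hr', hfwd r r' hc⟩
  · obtain ⟨r, hr, hc⟩ := exists_isClose_iUnion hXq hXp hXZ hr'
    exact ⟨r, hr, hbwd r r' hc⟩

end GoodData

/-! ### Sample complexity: error summation and union bound -/

section Final

variable {S A : Type*} [Fintype S] [Fintype A] [DecidableEq S] [DecidableEq A] {H : ℕ}
  {μ₀ : stdSimplex ℝ S} {p : Transition S A H}

/-- The states that can follow `(s, a)` at stage `h`. -/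
def successors (p : Transition S A H) (h : Fin H) (s : S) (a : A) : Finset S :=
  Finset.univ.filter fun s' => 0 < p h s a s'

theorem card_successors_le [Nonempty S] [Nonempty A] {π : Policy S A H} {h : Fin H}
    (hh : h.val + 1 < H) {s : S} {a : A} (hz : (s, a, h) ∈ suppSA μ₀ p π) :
    (successors p h s a).card ≤ suppSMax μ₀ p π := by
  refine le_trans ?_ (Finset.le_sup (f := fun h : Fin H =>
    {s : S | (s, h) ∈ suppS μ₀ p π}.ncard) (Finset.mem_univ (⟨h.val + 1, hh⟩ : Fin H)))
  rw [← Set.ncard_coe_finset]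
  refine Set.ncard_le_ncard (fun s' hs' => ?_) (Set.toFinite _)
  exact suppS_next (h' := ⟨h.val + 1, hh⟩) rfl hz (Finset.mem_filter.1 hs').2

/-- The exponential of the excess of the deviations over the level `t`. -/
def deviationExcess (p : Transition S A H) {τ : ℕ} (l t : ℝ) (h : Fin H) (s : S) (a : A)
    (D : Dataset S A H τ) : ℝ :=
  if hh : h.val + 1 < H then
    Real.exp (l * ∑ s' ∈ successors p h s a, |∑ i, deviation p hh s a (D i) s'| -
      2 * l ^ 2 * visits h s a D - t)
  else 0

theorem deviationExcess_nonneg {τ : ℕ} (l t : ℝ) (h : Fin H) (s : S) (a : A)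
    (D : Dataset S A H τ) : 0 ≤ deviationExcess p l t h s a D := by
  unfold deviationExcess
  split_ifs
  · exact (Real.exp_pos _).le
  · exact le_rfl

theorem sum_dataWeight_mul_deviationExcess_le [Nonempty S] [Nonempty A] {π : Policy S A H}
    {τ : ℕ} {l L : ℝ} (hl : 0 ≤ l) {h : Fin H} {s : S} {a : A}
    (hz : (s, a, h) ∈ suppSA μ₀ p π) :
    ∑ D : Dataset S A H τ, dataWeight μ₀ p π D *
      deviationExcess p l (L + suppSMax μ₀ p π) h s a D ≤ Real.exp (-L) := by
  by_cases hh : h.val + 1 < H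
  · set M := suppSMax μ₀ p π with hM
    simp only [deviationExcess, dif_pos hh, sub_eq_add_neg _ (L + (M : ℝ)), Real.exp_add]
    simp only [← mul_assoc, ← Finset.sum_mul]
    refine (mul_le_mul_of_nonneg_right (sum_dataWeight_mul_exp_deviation_le μ₀ p π hh s a _ hl)
      (Real.exp_pos _).le).trans ?_
    -- The sign patterns cost only e^M, because successors of a supported pair are supported at the
    -- next stage. The summand M of the level `t` pays for them.
    have h2 : (2 : ℝ) ^ (successors p h s a).card ≤ Real.exp M := by
      calc (2 : ℝ) ^ (successors p h s a).card ≤ 2 ^ M :=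
            pow_le_pow_right₀ (by norm_num) (card_successors_le hh hz)
        _ ≤ Real.exp 1 ^ M := by
            refine pow_le_pow_left₀ (by norm_num) ?_ _
            linarith [Real.add_one_le_exp (1 : ℝ)]
        _ = Real.exp M := by rw [← Real.exp_nat_mul, mul_one]
    calc _ ≤ Real.exp M * Real.exp (-(L + M)) :=
          mul_le_mul_of_nonneg_right h2 (Real.exp_pos _).le
      _ = Real.exp (-L) := by rw [← Real.exp_add]; congr 1; ring
  · simp only [deviationExcess, dif_neg hh, mul_zero, Finset.sum_const_zero]
    exact (Real.exp_pos _).le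

/-- If all three tail events fail at `(s, a, h)`, then the empirical transitions are accurate. -/
theorem mul_dist_empModel_le {π : Policy S A H} {τ : ℕ} {D : Dataset S A H τ} (hτ : 0 < τ)
    (hD : ∀ i, 0 < trajProb μ₀ p π (D i))
    (hseen : ∀ s a h, (s, a, h) ∈ suppSA μ₀ p π → ∃ i, D i h = (s, a)) {t : ℝ} (ht : 0 < t)
    {h : Fin H} {s : S} {a : A} (hz : (s, a, h) ∈ suppSA μ₀ p π)
    (hlow : Real.exp (τ * visitSA μ₀ p π h s a / 2 - visits h s a D - t) < 1)
    (hdev : deviationExcess p √(t / (τ * visitSA μ₀ p π h s a)) t h s a D < 1) :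
    visitSA μ₀ p π h s a * ∑ s', |p h s a s' - empModel μ₀ p π D hseen h s a s'| ≤
      6 * √(visitSA μ₀ p π h s a * t / τ) := by
  by_cases hh : h.val + 1 < H
  · rw [deviationExcess, dif_pos hh, Real.exp_lt_one_iff] at hdev
    rw [Real.exp_lt_one_iff] at hlow
    set q := empModel μ₀ p π D hseen with hq
    have hN : 0 < visits h s a D := zero_lt_one.trans_le (one_le_visits (hseen s a h hz))
    refine mul_deviation_le_sqrt (N := visits h s a D) (Nat.cast_pos.2 hτ) ht hz ?_
      (by linarith) ?_
    · calc ∑ s', |p h s a s' - q h s a s'| ≤ ∑ s', (p h s a s' + q h s a s') :=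
            Finset.sum_le_sum fun s' _ => by
              refine (abs_sub _ _).trans ?_
              rw [abs_of_nonneg (stdSimplex.zero_le _ _), abs_of_nonneg (stdSimplex.zero_le _ _)]
        _ = 2 := by
            rw [Finset.sum_add_distrib, stdSimplex.sum_eq_one, stdSimplex.sum_eq_one]
            norm_num
    -- Restricting to successors loses nothing: outside them both the true and the empirical
    -- probabilities vanish.
    · have hsum : visits h s a D * ∑ s', |p h s a s' - q h s a s'| =
          ∑ s' ∈ successors p h s a, |∑ i, deviation p hh s a (D i) s'| := by
        rw [Finset.mul_sum]
        symm
        refine (Finset.sum_congr rfl fun s' _ => ?_).trans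
          (Finset.sum_subset (Finset.subset_univ _) fun s' _ hs' => ?_)
        · rw [sum_deviation, hq, empModel_apply hseen hh hz,
            empTransition_eq hh (hseen s a h hz), abs_sub_comm, ← abs_of_pos hN, ← abs_mul,
            abs_of_pos hN]
          congr 1
          field_simp
        · have hp0 : p h s a s' = 0 := by
            refine le_antisymm (not_lt.1 fun h0 => hs' ?_) (stdSimplex.zero_le _ _)
            exact Finset.mem_filter.2 ⟨Finset.mem_univ _, h0⟩
          have hq0 : q h s a s' = 0 := by
            refine le_antisymm (not_lt.1 fun h0 => ?_) (stdSimplex.zero_le _ _)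
            exact (transition_pos_of_empModel_pos hseen hD h0).ne' hp0
          rw [hp0, hq0, sub_self, abs_zero, mul_zero]
      rw [hsum]
      linarith
  · simp only [empModel_of_last hseen hh, sub_self, abs_zero, Finset.sum_const_zero, mul_zero]
    positivity

/-- Cauchy–Schwarz on the support, where the visitation probabilities have total mass `H`, one per
stage. The number of triples therefore enters only through the support. -/
theorem sum_sqrt_visitSA_le [Nonempty S] [Nonempty A] (π : Policy S A H) :
    ∑ h, ∑ s, ∑ a, √(visitSA μ₀ p π h s a) ≤ √((suppSA μ₀ p π).ncard * H) := by
  classical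
  set f : S × A × Fin H → ℝ := fun x => visitSA μ₀ p π x.2.2 x.1 x.2.1 with hf
  have hre : ∀ g : ℝ → ℝ, ∑ h, ∑ s, ∑ a, g (visitSA μ₀ p π h s a) = ∑ x, g (f x) := by
    intro g
    rw [Finset.sum_comm, Fintype.sum_prod_type]
    refine Finset.sum_congr rfl fun s _ => ?_
    rw [Finset.sum_comm, Fintype.sum_prod_type]
  set Zf := (suppSA μ₀ p π).toFinite.toFinset with hZf
  have hsub : ∀ g : ℝ → ℝ, g 0 = 0 → ∑ x, g (f x) = ∑ x ∈ Zf, g (f x) := by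
    intro g hg
    refine (Finset.sum_subset (Finset.subset_univ _) fun x _ hx => ?_).symm
    have hx0 : f x = 0 := le_antisymm (not_lt.1 fun h0 => hx ((Set.Finite.mem_toFinset _).2 h0))
      (visitSA_nonneg _ _ _ _ _ _)
    rw [hx0, hg]
  rw [hre Real.sqrt, hsub _ Real.sqrt_zero]
  refine Real.le_sqrt_of_sq_le ?_
  have hcs := sq_sum_le_card_mul_sum_sq (s := Zf) (f := fun x => √(f x))
  have h1 : ∑ x ∈ Zf, √(f x) ^ 2 = H := by
    rw [Finset.sum_congr rfl fun x _ => Real.sq_sqrt (visitSA_nonneg μ₀ p π _ _ _),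
      ← hsub (fun y => y) rfl, ← hre fun y => y]
    simp [sum_visitSA]
  rwa [h1, hZf, ← Set.ncard_eq_toFinset_card] at hcs

theorem mul_modelDist_le [Nonempty S] [Nonempty A] (π : Policy S A H) {q : Transition S A H}
    {t τ ε : ℝ} (hτ : 0 < τ) (ht : 0 < t) (hε : 0 < ε)
    (hq : ∀ s a h, (s, a, h) ∈ suppSA μ₀ p π → visitSA μ₀ p π h s a *
      ∑ s', |p h s a s' - q h s a s'| ≤ 6 * √(visitSA μ₀ p π h s a * t / τ))
    (hbound : 36 * (H ^ 3 * (suppSA μ₀ p π).ncard * t) ≤ τ * ε ^ 2) :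
    H * modelDist μ₀ p π q ≤ ε := by
  have h1 : modelDist μ₀ p π q ≤
      6 * √(t / τ) * ∑ h, ∑ s, ∑ a, √(visitSA μ₀ p π h s a) := by
    simp only [modelDist, Finset.mul_sum]
    refine Finset.sum_le_sum fun h _ => Finset.sum_le_sum fun s _ =>
      Finset.sum_le_sum fun a _ => ?_
    rw [← Finset.mul_sum]
    rcases (visitSA_nonneg μ₀ p π h s a).eq_or_lt with h0 | h0
    · rw [← h0, zero_mul, Real.sqrt_zero, mul_zero]
    · refine (hq s a h h0).trans (le_of_eq ?_)
      rw [mul_assoc, ← Real.sqrt_mul (div_pos ht hτ).le]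
      congr 2
      ring
  have h2 := h1.trans (mul_le_mul_of_nonneg_left (sum_sqrt_visitSA_le π) (by positivity))
  rw [mul_assoc, ← Real.sqrt_mul (div_pos ht hτ).le] at h2
  refine (mul_le_mul_of_nonneg_left h2 (Nat.cast_nonneg H)).trans ?_
  refine abs_le_of_sq_le_sq' ?_ hε.le |>.2
  rw [mul_pow, mul_pow, Real.sq_sqrt (by positivity)]
  have h3 : (H : ℝ) ^ 2 * (6 ^ 2 * (t / τ * ((suppSA μ₀ p π).ncard * H))) =
      36 * (H ^ 3 * (suppSA μ₀ p π).ncard * t) / τ := by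
    field_simp
    ring
  rw [h3, div_le_iff₀ hτ]
  linarith

theorem suppSA_nonempty [Nonempty S] [Nonempty A] (hH : 0 < H) (π : Policy S A H) :
    (suppSA μ₀ p π).Nonempty := by
  have hpos : 0 < ∑ ω, trajProb μ₀ p π ω := by rw [sum_trajProb]; exact one_pos
  obtain ⟨ω, -, hω⟩ := Finset.exists_lt_of_sum_lt (f := fun _ => (0 : ℝ))
    (Finset.sum_const_zero.trans_lt hpos)
  exact ⟨((ω ⟨0, hH⟩).1, (ω ⟨0, hH⟩).2, ⟨0, hH⟩), mem_suppSA_iff.2 ⟨ω, hω, rfl⟩⟩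

theorem visitMin_pos [Nonempty S] [Nonempty A] (hH : 0 < H) (π : Policy S A H) :
    0 < visitMin μ₀ p π := by
  have : Nonempty (suppSA μ₀ p π) := (suppSA_nonempty hH π).to_subtype
  obtain ⟨x, hx⟩ := exists_eq_ciInf_of_finite
    (f := fun x : suppSA μ₀ p π => visitSA μ₀ p π x.1.2.2 x.1.1 x.1.2.1)
  rw [visitMin, ← hx]
  exact x.2

theorem visitMin_le {π : Policy S A H} {s : S} {a : A} {h : Fin H}
    (hz : (s, a, h) ∈ suppSA μ₀ p π) : visitMin μ₀ p π ≤ visitSA μ₀ p π h s a :=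
  ciInf_le (f := fun x : suppSA μ₀ p π => visitSA μ₀ p π x.1.2.2 x.1.1 x.1.2.1)
    (Set.finite_range _).bddBelow ⟨(s, a, h), hz⟩

/-- A union bound in the form of two nonnegative functions of the two datasets. -/
theorem isPAC_of_bad [Nonempty S] [Nonempty A] {πE : DetPolicy S A H} {πb : Policy S A H}
    {ε δ δb δE : ℝ} {τb τE : ℕ}
    {alg : Dataset S A H τb × Dataset S A H τE → Set (Reward S A H) × Set (Reward S A H)}
    (Bb : Dataset S A H τb → ℝ) (BE : Dataset S A H τE → ℝ)
    (hb0 : ∀ D, 0 ≤ Bb D) (hE0 : ∀ D, 0 ≤ BE D)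
    (hb : ∑ D, dataWeight μ₀ p πb D * Bb D ≤ δb)
    (hE : ∑ D, dataWeight μ₀ p πE.toPolicy D * BE D ≤ δE) (hδ : δb + δE ≤ δ)
    (hgood : ∀ Db DE, (∀ i, 0 < trajProb μ₀ p πb (Db i)) →
      (∀ i, 0 < trajProb μ₀ p πE.toPolicy (DE i)) → Bb Db < 1 → BE DE < 1 →
      hausdorff (rewardDist μ₀ p πb) (subFeasible μ₀ p πE πb) (alg (Db, DE)).1 ≤
          ENNReal.ofReal ε ∧
        hausdorff (rewardDist μ₀ p πb) (superFeasible μ₀ p πE πb) (alg (Db, DE)).2 ≤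
          ENNReal.ofReal ε) :
    IsPAC μ₀ p πE πb ε δ alg := by
  have hpos : ∀ {τ : ℕ} {π : Policy S A H} {D : Dataset S A H τ}, dataWeight μ₀ p π D ≠ 0 →
      ∀ i, 0 < trajProb μ₀ p π (D i) := by
    intro τ π D hw i
    exact (trajProb_nonneg μ₀ p π (D i)).lt_of_ne'
      (Finset.prod_ne_zero_iff.1 hw i (Finset.mem_univ i))
  have hsum : ∑ D : Dataset S A H τb × Dataset S A H τE,
      dataWeight μ₀ p πb D.1 * dataWeight μ₀ p πE.toPolicy D.2 * (1 - Bb D.1 - BE D.2) =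
      1 - ∑ D, dataWeight μ₀ p πb D * Bb D - ∑ D, dataWeight μ₀ p πE.toPolicy D * BE D := by
    have h1 : ∀ (u : Dataset S A H τb → ℝ) (v : Dataset S A H τE → ℝ),
        ∑ D : Dataset S A H τb × Dataset S A H τE, u D.1 * v D.2 = (∑ D, u D) * ∑ D, v D :=
      fun u v => by rw [Fintype.sum_prod_type, Finset.sum_mul_sum]
    have h2 := h1 (dataWeight μ₀ p πb) (dataWeight μ₀ p πE.toPolicy)
    have h3 := h1 (fun D => dataWeight μ₀ p πb D * Bb D) (dataWeight μ₀ p πE.toPolicy)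
    have h4 := h1 (dataWeight μ₀ p πb) (fun D => dataWeight μ₀ p πE.toPolicy D * BE D)
    rw [sum_dataWeight] at h2 h3
    rw [sum_dataWeight] at h2 h4
    rw [mul_one] at h2 h3
    rw [one_mul] at h4
    rw [← h3, ← h4]
    refine Eq.trans ?_ (congrArg (fun y => y - _ - _) h2)
    rw [← Finset.sum_sub_distrib, ← Finset.sum_sub_distrib]
    exact Finset.sum_congr rfl fun D _ => by ring
  have hle : 1 - δ ≤ ∑ D : Dataset S A H τb × Dataset S A H τE,
      dataWeight μ₀ p πb D.1 * dataWeight μ₀ p πE.toPolicy D.2 * (1 - Bb D.1 - BE D.2) := by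
    rw [hsum]
    linarith
  -- Pointwise, the indicator of success dominates `1 - Bb - BE` on datasets of positive weight: if
  -- success fails, one of the two functions is at least 1 and the other is nonnegative.
  refine hle.trans (Finset.sum_le_sum fun D _ => ?_)
  obtain ⟨Db, DE⟩ := D
  have hwb := dataWeight_nonneg μ₀ p πb Db
  have hwE := dataWeight_nonneg μ₀ p πE.toPolicy DE
  have hw := mul_nonneg hwb hwE
  have hb0 := hb0 Db
  have hE0 := hE0 DE
  by_cases hmem : (Db, DE) ∈ {D | hausdorff (rewardDist μ₀ p πb) (subFeasible μ₀ p πE πb)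
      (alg D).1 ≤ ENNReal.ofReal ε ∧ hausdorff (rewardDist μ₀ p πb) (superFeasible μ₀ p πE πb)
      (alg D).2 ≤ ENNReal.ofReal ε}
  · rw [Set.indicator_of_mem hmem]
    exact mul_le_of_le_one_right hw (by linarith)
  · rw [Set.indicator_of_notMem hmem]
    rcases hw.eq_or_lt with h0 | h0
    · simp only [← h0, zero_mul, le_refl]
    · refine mul_nonpos_of_nonneg_of_nonpos hw ?_
      by_contra! hlt
      exact hmem (hgood Db DE (hpos (left_ne_zero_of_mul h0.ne'))
        (hpos (right_ne_zero_of_mul h0.ne')) (by simp only at hlt; linarith)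
        (by simp only at hlt; linarith))

/-- The bad event of the behavioral data: some triple of the support is unseen, seldom seen, or
followed by states with inaccurate frequencies. -/
def behavioralBad (μ₀ : stdSimplex ℝ S) (p : Transition S A H) (π : Policy S A H) {τ : ℕ} (t : ℝ)
    (D : Dataset S A H τ) : ℝ :=
  ∑ x ∈ (suppSA μ₀ p π).toFinite.toFinset, (unseen x.2.2 x.1 x.2.1 D +
    Real.exp (τ * visitSA μ₀ p π x.2.2 x.1 x.2.1 / 2 - visits x.2.2 x.1 x.2.1 D - t) +
    deviationExcess p √(t / (τ * visitSA μ₀ p π x.2.2 x.1 x.2.1)) t x.2.2 x.1 x.2.1 D)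

/-- The bad event of the expert's data: some pair of the support is unseen. -/
def expertBad (μ₀ : stdSimplex ℝ S) (p : Transition S A H) (π : DetPolicy S A H) {τ : ℕ}
    (D : Dataset S A H τ) : ℝ :=
  ∑ x ∈ (suppS μ₀ p π.toPolicy).toFinite.toFinset, unseen x.2 x.1 (π x.2 x.1) D

theorem behavioralBad_nonneg {π : Policy S A H} {τ : ℕ} {t : ℝ} (D : Dataset S A H τ) :
    0 ≤ behavioralBad μ₀ p π t D :=
  Finset.sum_nonneg fun _ _ => add_nonneg (add_nonneg (unseen_nonneg _ _ _ D)
    (Real.exp_pos _).le) (deviationExcess_nonneg _ _ _ _ _ D)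

theorem expertBad_nonneg {π : DetPolicy S A H} {τ : ℕ} (D : Dataset S A H τ) :
    0 ≤ expertBad μ₀ p π D :=
  Finset.sum_nonneg fun _ _ => unseen_nonneg _ _ _ D

theorem of_behavioralBad_lt_one {π : Policy S A H} {τ : ℕ} {t : ℝ} {D : Dataset S A H τ}
    (hD : behavioralBad μ₀ p π t D < 1) {s : S} {a : A} {h : Fin H}
    (hz : (s, a, h) ∈ suppSA μ₀ p π) :
    unseen h s a D < 1 ∧
      Real.exp (τ * visitSA μ₀ p π h s a / 2 - visits h s a D - t) < 1 ∧
      deviationExcess p √(t / (τ * visitSA μ₀ p π h s a)) t h s a D < 1 := by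
  have h1 : (s, a, h) ∈ (suppSA μ₀ p π).toFinite.toFinset := (Set.Finite.mem_toFinset _).2 hz
  have h2 := (Finset.single_le_sum (fun x _ => add_nonneg (add_nonneg
    (unseen_nonneg x.2.2 x.1 x.2.1 D) (Real.exp_pos
      (τ * visitSA μ₀ p π x.2.2 x.1 x.2.1 / 2 - visits x.2.2 x.1 x.2.1 D - t)).le)
    (deviationExcess_nonneg (p := p) √(t / (τ * visitSA μ₀ p π x.2.2 x.1 x.2.1)) t x.2.2 x.1
      x.2.1 D)) h1).trans_lt hD
  simp only at h2
  have h3 := unseen_nonneg h s a D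
  have h4 := Real.exp_pos (τ * visitSA μ₀ p π h s a / 2 - visits h s a D - t)
  have h5 := deviationExcess_nonneg (p := p) √(t / (τ * visitSA μ₀ p π h s a)) t h s a D
  exact ⟨by linarith, by linarith, by linarith⟩

theorem sum_dataWeight_mul_behavioralBad_le [Nonempty S] [Nonempty A] {π : Policy S A H} {τ : ℕ}
    {L : ℝ} (hunseen : ∀ s a h, (s, a, h) ∈ suppSA μ₀ p π →
      (1 - visitSA μ₀ p π h s a) ^ τ ≤ Real.exp (-L)) :
    ∑ D : Dataset S A H τ, dataWeight μ₀ p π D *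
        behavioralBad μ₀ p π (L + suppSMax μ₀ p π) D ≤
      (suppSA μ₀ p π).ncard * (3 * Real.exp (-L)) := by
  simp only [behavioralBad, Finset.mul_sum]
  rw [Finset.sum_comm, Set.ncard_eq_toFinset_card, ← nsmul_eq_mul]
  refine Finset.sum_le_card_nsmul _ _ _ ?_
  rintro ⟨s, a, h⟩ hx
  have hz : (s, a, h) ∈ suppSA μ₀ p π := (Set.Finite.mem_toFinset _).1 hx
  simp only [mul_add, Finset.sum_add_distrib]
  have h1 := (sum_dataWeight_mul_unseen μ₀ p π (τ := τ) h s a).trans_le (hunseen s a h hz)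
  have h3 := sum_dataWeight_mul_deviationExcess_le (τ := τ) (L := L)
    (l := √((L + suppSMax μ₀ p π) / (τ * visitSA μ₀ p π h s a))) (Real.sqrt_nonneg _) hz
  have h2 : ∑ D : Dataset S A H τ, dataWeight μ₀ p π D *
      Real.exp (τ * visitSA μ₀ p π h s a / 2 - visits h s a D - (L + suppSMax μ₀ p π)) ≤
      Real.exp (-L) := by
    simp only [sub_eq_add_neg _ (L + (suppSMax μ₀ p π : ℝ)), Real.exp_add _ (-(L + _))]
    simp only [← mul_assoc, ← Finset.sum_mul]
    refine (mul_le_of_le_one_left (Real.exp_pos _).le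
      (sum_dataWeight_mul_exp_neg_visits_le μ₀ p π h s a)).trans ?_
    refine Real.exp_le_exp.2 ?_
    have : (0 : ℝ) ≤ suppSMax μ₀ p π := Nat.cast_nonneg _
    linarith
  linarith

theorem sum_dataWeight_mul_expertBad_le [Nonempty S] [Nonempty A] {π : DetPolicy S A H} {τ : ℕ}
    {c : ℝ} (hunseen : ∀ s a h, (s, a, h) ∈ suppSA μ₀ p π.toPolicy →
      (1 - visitSA μ₀ p π.toPolicy h s a) ^ τ ≤ c) :
    ∑ D : Dataset S A H τ, dataWeight μ₀ p π.toPolicy D * expertBad μ₀ p π D ≤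
      (suppS μ₀ p π.toPolicy).ncard * c := by
  simp only [expertBad, Finset.mul_sum]
  rw [Finset.sum_comm, Set.ncard_eq_toFinset_card, ← nsmul_eq_mul]
  refine Finset.sum_le_card_nsmul _ _ _ ?_
  rintro ⟨s, h⟩ hx
  rw [sum_dataWeight_mul_unseen]
  exact hunseen _ _ _ (mem_suppSA_of_mem_suppS ((Set.Finite.mem_toFinset _).1 hx))

theorem exp_neg_log_div {N δ : ℝ} (hN : 0 < N) (hδ : 0 < δ) :
    N * Real.exp (-Real.log (4 * N / δ)) = δ / 4 := by
  rw [Real.exp_neg, Real.exp_log (by positivity)]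
  field_simp

theorem one_le_log_div {N δ : ℝ} (hN : 1 ≤ N) (hδ : 0 < δ) (hδ1 : δ < 1) :
    1 ≤ Real.log (4 * N / δ) := by
  rw [Real.le_log_iff_exp_le (by positivity), le_div_iff₀ hδ]
  nlinarith [Real.exp_one_lt_d9, Real.exp_pos 1]

end Final

end

end OfflineIRL

open OfflineIRL in
theorem theorem5p1 :
    ∃ C : ℝ, 0 < C ∧
      ∀ (S A : Type*) [Fintype S] [Fintype A] [DecidableEq S] [DecidableEq A] (H : ℕ)
        (μ₀ : stdSimplex ℝ S) (p : Transition S A H)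
        (πE : DetPolicy S A H) (πb : Policy S A H),
        (∀ s h, (s, h) ∈ suppS μ₀ p πE.toPolicy → 0 < πb h s (πE h s)) →
        ∀ ε δ : ℝ, 0 < ε → ε ≤ 2 * H → 0 < δ → δ < 1 →
        ∀ τb τE : ℕ, 1 ≤ τE →
          C * behavioralBound μ₀ p πb ε δ ≤ τb →
          C * expertBound μ₀ p πE δ ≤ τE →
          ∀ est : Dataset S A H τE → DetPolicy S A H, (∀ D, IsEmpPolicy D (est D)) →
            IsPAC (τb := τb) μ₀ p πE πb ε δ (irlo est) := by
  -- This is 6², from the square of the row estimate 6√(ρt/τ).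
  refine ⟨36, by norm_num, ?_⟩
  intro S A _ _ _ _ H μ₀ p πE πb hcov ε δ hε hεH hδ hδ1 τb τE hτE1 hτb hτE est hest
  have hH : 0 < H := by
    by_contra h
    obtain rfl : H = 0 := by omega
    norm_num at hεH
    linarith
  have : Nonempty S := by
    by_contra h
    have := not_nonempty_iff.1 h
    simpa using stdSimplex.sum_eq_one μ₀
  obtain ⟨s₀⟩ := ‹Nonempty S›
  have : Nonempty S := ⟨s₀⟩
  have : Nonempty A := ⟨πE ⟨0, hH⟩ s₀⟩
  set Z : ℝ := (((suppSA μ₀ p πb).ncard : ℕ) : ℝ) with hZ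
  set M : ℝ := ((suppSMax μ₀ p πb : ℕ) : ℝ) with hM
  set L : ℝ := Real.log (4 * Z / δ) with hL
  set N : ℝ := (((suppS μ₀ p πE.toPolicy).ncard : ℕ) : ℝ) with hN
  have hZ1 : 1 ≤ Z := by
    rw [hZ, Nat.one_le_cast, Nat.one_le_iff_ne_zero, Ne, Set.ncard_eq_zero (Set.toFinite _)]
    exact (suppSA_nonempty hH πb).ne_empty
  have hN1 : 1 ≤ N := by
    rw [hN, Nat.one_le_cast, Nat.one_le_iff_ne_zero, Ne, Set.ncard_eq_zero (Set.toFinite _)]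
    obtain ⟨⟨s, a, h⟩, hx⟩ := suppSA_nonempty (μ₀ := μ₀) (p := p) hH πE.toPolicy
    obtain ⟨ω, hω, he⟩ := mem_suppSA_iff.1 hx
    exact Set.Nonempty.ne_empty ⟨(s, h), mem_suppS_iff.2 ⟨ω, hω, by rw [he]⟩⟩
  have hL1 : 1 ≤ L := one_le_log_div hZ1 hδ hδ1
  have hM0 : 0 ≤ M := Nat.cast_nonneg _
  have hH1 : (1 : ℝ) ≤ H := Nat.one_le_cast.2 hH
  set X : ℝ := (H : ℝ) ^ 3 * Z * L / ε ^ 2 with hX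
  have hX0 : 0 < X := by positivity
  have hlog : 1 ≤ Real.log (Real.exp 1 + X) := by
    rw [Real.le_log_iff_exp_le (by positivity)]
    linarith
  have hbb : behavioralBound μ₀ p πb ε δ = X * (L + M * Real.log (Real.exp 1 + X)) +
      L / Real.log (1 / (1 - visitMin μ₀ p πb)) := rfl
  have hvis1 : ∀ π : Policy S A H, visitMin μ₀ p π ≤ 1 := fun π => by
    obtain ⟨⟨s, a, h⟩, hx⟩ := suppSA_nonempty (μ₀ := μ₀) (p := p) hH π
    exact (visitMin_le hx).trans (visitSA_le_one μ₀ p π h s a)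
  have hquot : 0 ≤ L / Real.log (1 / (1 - visitMin μ₀ p πb)) := by
    refine div_nonneg (by linarith) ?_
    rw [one_div, Real.log_inv, neg_nonneg]
    exact Real.log_nonpos (by linarith [hvis1 πb]) (by
      linarith [visitMin_pos (μ₀ := μ₀) (p := p) hH πb])
  set t : ℝ := L + M with ht
  have ht0 : 0 < t := by linarith
  -- The argument needs only H³Z(L + M)/ε²; the further factor `L` in `X` and the logarithm are at
  -- least 1 and are discarded.
  have hXt : (H : ℝ) ^ 3 * Z * t / ε ^ 2 ≤ X * (L + M * Real.log (Real.exp 1 + X)) := by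
    have h1 : (H : ℝ) ^ 3 * Z / ε ^ 2 ≤ X := by
      exact div_le_div_of_nonneg_right (le_mul_of_one_le_right (by positivity) hL1)
        (sq_nonneg ε)
    calc (H : ℝ) ^ 3 * Z * t / ε ^ 2 = (H : ℝ) ^ 3 * Z / ε ^ 2 * t := by ring
      _ ≤ X * (L + M * Real.log (Real.exp 1 + X)) := by
          refine mul_le_mul h1 ?_ ht0.le hX0.le
          rw [ht]
          gcongr
          exact le_mul_of_one_le_right hM0 hlog
  have hmain : 36 * ((H : ℝ) ^ 3 * Z * t / ε ^ 2) ≤ τb := by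
    rw [hbb] at hτb
    linarith
  have hτb0 : (0 : ℝ) < τb := lt_of_lt_of_le (by positivity) hmain
  have hτb1 : 1 ≤ τb := Nat.cast_pos.1 hτb0
  have hbound : 36 * ((H : ℝ) ^ 3 * Z * t) ≤ τb * ε ^ 2 := by
    rw [← mul_div_assoc, div_le_iff₀ (by positivity)] at hmain
    exact hmain
  have hunb : ∀ s a h, (s, a, h) ∈ suppSA μ₀ p πb →
      (1 - visitSA μ₀ p πb h s a) ^ τb ≤ Real.exp (-L) := by
    intro s a h hz
    refine one_sub_pow_le_exp_neg (C := 36) (visitMin_pos hH πb) (visitMin_le hz)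
      (visitSA_le_one μ₀ p πb h s a) (by linarith) (by norm_num) hτb1 ?_
    rw [hbb] at hτb
    have : 0 ≤ X * (L + M * Real.log (Real.exp 1 + X)) := by positivity
    linarith
  have hunE : ∀ s a h, (s, a, h) ∈ suppSA μ₀ p πE.toPolicy →
      (1 - visitSA μ₀ p πE.toPolicy h s a) ^ τE ≤ Real.exp (-Real.log (4 * N / δ)) := by
    intro s a h hz
    exact one_sub_pow_le_exp_neg (C := 36) (visitMin_pos hH _) (visitMin_le hz)
      (visitSA_le_one μ₀ p _ h s a) (by linarith [one_le_log_div hN1 hδ hδ1]) (by norm_num)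
      hτE1 hτE
  have hsb := sum_dataWeight_mul_behavioralBad_le hunb
  have hsE := sum_dataWeight_mul_expertBad_le hunE
  have heb := exp_neg_log_div (zero_lt_one.trans_le hZ1) hδ
  have heE := exp_neg_log_div (zero_lt_one.trans_le hN1) hδ
  -- The budgets are Z · 3e^(-L) = 3δ/4 for the behavioral data and δ/4 for the expert's data.
  refine isPAC_of_bad (behavioralBad μ₀ p πb t) (expertBad μ₀ p πE) behavioralBad_nonneg
    expertBad_nonneg hsb hsE (by linarith) ?_
  intro Db DE hDb hDE hBb hBE
  have hseen : ∀ s a h, (s, a, h) ∈ suppSA μ₀ p πb → ∃ i, Db i h = (s, a) :=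
    fun s a h hz => exists_of_unseen_lt_one (of_behavioralBad_lt_one hBb hz).1
  refine irlo_hausdorff_le hseen hH hcov hDb hDE ?_ (hest DE) ?_
  · intro s h hs
    have h1 : unseen h s (πE h s) DE < 1 :=
      (Finset.single_le_sum (f := fun x : S × Fin H => unseen x.2 x.1 (πE x.2 x.1) DE)
        (fun x _ => unseen_nonneg _ _ _ DE)
        ((Set.Finite.mem_toFinset (Set.toFinite (suppS μ₀ p πE.toPolicy))).2 hs)).trans_lt hBE
    obtain ⟨i, hi⟩ := exists_of_unseen_lt_one h1
    exact ⟨i, by rw [hi]⟩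
  · refine mul_modelDist_le πb hτb0 ht0 hε (fun s a h hz => ?_) hbound
    obtain ⟨-, h2, h3⟩ := of_behavioralBad_lt_one hBb hz
    exact mul_dist_empModel_le hτb1 hDb hseen ht0 hz h2 h3
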